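/- Let $m,n,r\ge 0$ be integers with $m,n$ not both zero, and put $\hat i=0$ for $1\le i\le m$, $\hat i=1$ for $m<i\le m+n$ (in $\mathbb Z/2$). Let $R$ be a commutative $\mathbb Z[\upsilon,\upsilon^{-1}]$-algebra, $v\in R$ the image of $\upsilon$, $q=v^2$. Let $\mathcal H_R$ be the Hecke algebra of $\mathfrak S_r$ over $R$, with basis $\{T_w\}$ and relations $T_s^2=(q-1)T_s+q$ for simple transpositions $s$, and $T_yT_w=T_{yw}$ if $l(yw)=l(y)+l(w)$. Let $\Lambda(m|n,r)$ be the set of pairs $\lambda|\mu$ of compositions with $m$ and $n$ parts (zeros allowed) and $|\lambda|+|\mu|=r$. For $\lambda|\mu\in\Lambda(m|n,r)$ let $R_1,\dots,R_{m+n}$ be the consecutive intervals of $\{1,\dots,r\}$ of sizes $\lambda_1,\dots,\lambda_m,\mu_1,\dots,\mu_n$ (written $R_i^{\lambda|\mu}$ when the weight must be specified), $\mathfrak S_{\lambda|\mu}$ their common stabilizer, and $\mathfrak S_{\lambda^*}$ (resp. $\mathfrak S_{{}^*\mu}$) its subgroup fixing all points of the last $n$ (resp. first $m$) intervals. Put $$x_\lambda=\sum_{w\in\mathfrak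 S_{\lambda^*}}T_w,\qquad y_\mu=\sum_{w\in\mathfrak S_{{}^*\mu}}(-q)^{-l(w)}T_w .$$ The quantum Schur superalgebra is $$\mathcal S(m|n,r;R)=\mathrm{End}_{\mathcal H_R}\Bigl(\bigoplus_{\lambda|\mu\in\Lambda(m|n,r)}x_\lambda y_\mu\mathcal H_R\Bigr),$$ where $\mathrm{Hom}_{\mathcal H_R}(x_\xi y_\eta\mathcal H_R,x_\lambda y_\mu\mathcal H_R)$ has degree $|\mu|+|\eta|$ mod $2$ and the product is the supermultiplication $fg=(-1)^{ij}f\circ g$ for $f,g$ homogeneous of degrees $i,j$. Write $\mathcal S(m|n,r)$ for the case $R=\mathbb Z[\upsilon,\upsilon^{-1}]$. Let $M(m|n,r)$ be the set of $(m+n)\times(m+n)$ matrices $A=(a_{ij})$ over $\mathbb N$ with $\sum a_{ij}=r$ and $a_{ij}\in\{0,1\}$ whenever $\hat i+\hat j=1$. For $A\in M(m|n,r)$ let $\lambda|\mu$ and $\xi|\eta$ be its vectors of row and column sums and let $d$ be the shortest element of the double coset $\{w\in\mathfrak S_r: |R_i^{\lambda|\mu}\cap wR_j^{\xi|\eta}|=a_{ij}\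 \forall i,j\}$ in $\mathfrak S_{\lambda|\mu}\backslash\mathfrak S_r/\mathfrak S_{\xi|\eta}$. Put $$T_A=\sum_{u,v}(-q)^{-l(v)}x_\lambda y_\mu T_dT_uT_v,$$ where $(u,v)$ runs over the pairs in $\mathfrak S_{\xi^*}\times\mathfrak S_{{}^*\eta}$ such that $uv$ has minimal length in its right coset with respect to the subgroup generated by $d^{-1}\mathfrak S_{\lambda^*}d\cap\mathfrak S_{\xi^*}$ and $d^{-1}\mathfrak S_{{}^*\mu}d\cap\mathfrak S_{{}^*\eta}$. Let $\phi_A\in\mathcal S(m|n,r;R)$ be defined by $\phi_A(x_\alpha y_\beta h)=\delta_{\alpha|\beta,\,\xi|\eta}\,T_Ah\in x_\lambda y_\mu\mathcal H_R$ for $\alpha|\beta\in\Lambda(m|n,r)$, $h\in\mathcal H_R$. **Theorem.** (1) The $\phi_A$, $A\in M(m|n,r)$, are well defined and $R$-linearly independent. (2) Suppose that $1+v^2$ is not a zero divisor in $R$, or that $m=0$, or $n=0$, or $r\le1$. Then $\{\phi_A: A\in M(m|n,r)\}$ is an $R$-basis of $\mathcal S(m|n,r;R)$. Hence there is an isomorphism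 $R\otimes_{\mathbb Z[\upsilon,\upsilon^{-1}]}\mathcal S(m|n,r)\cong\mathcal S(m|n,r;R)$ with $1\otimes\phi_A\mapsto\phi_A$, an $R$-algebra isomorphism both for the supermultiplication and for composition, and, if $R\ne0$, the rank of $\mathcal S(m|n,r;R)$ is $|M(m|n,r)|$. (3) $$|M(m|n,r)|=\sum_{k=0}^r\binom{m^2+n^2+k-1}{k}\binom{2mn}{r-k}.$$ (4) There is an $R$-linear anti-involution $\tau$ of $\mathcal S(m|n,r;R)$, for the supermultiplication and for composition, with $\tau(\phi_A)=\phi_{A^T}$ for all $A\in M(m|n,r)$, where $A^T$ is the transpose of $A$. -/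

import Mathlib

open scoped TensorProduct LaurentPolynomial

noncomputable section

namespace QSS

/-! ### Weights, matrices, row sets -/

/-- The parity `î ∈ ℤ/2` of an index: `0` for the first `m` indices, `1` for the last `n`. -/
def hat (m n : ℕ) (i : Fin (m + n)) : ZMod 2 := if (i : ℕ) < m then 0 else 1

/-- `Λ(m|n,r)`, identified with the compositions of `r` with `m + n` parts:
`lam|mu` is the concatenation `(lam_1, …, lam_m, mu_1, …, mu_n)`. -/
abbrev Weight (m n r : ℕ) : Type := {ν : Fin (m + n) → ℕ // ∑ i, ν i = r}

/-- `M(m|n,r)`: matrices over `ℕ` with entries summing to `r` and with entries `0` or `1` in the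
positions of odd parity. -/
def SMat (m n r : ℕ) : Type :=
  {A : Matrix (Fin (m + n)) (Fin (m + n)) ℕ //
    (∀ i j, hat m n i + hat m n j = 1 → A i j = 0 ∨ A i j = 1) ∧ ∑ i, ∑ j, A i j = r}

variable {m n r : ℕ}

/-- The row sums of `A`. -/
def SMat.ro (A : SMat m n r) : Weight m n r := ⟨fun i => ∑ j, A.1 i j, A.2.2⟩

/-- The column sums of `A`. -/
def SMat.co (A : SMat m n r) : Weight m n r :=
  ⟨fun j => ∑ i, A.1 i j, by rw [Finset.sum_comm]; exact A.2.2⟩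

/-- The transpose of `A`. -/
def SMat.transpose (A : SMat m n r) : SMat m n r :=
  ⟨A.1.transpose, fun i j h => A.2.1 j i (by rw [add_comm]; exact h),
    Finset.sum_comm.trans A.2.2⟩

/-- `|mu|` modulo `2` for the weight `lam|mu`. -/
def Weight.parity (ν : Weight m n r) : ZMod 2 := ∑ i, hat m n i * (ν.1 i : ZMod 2)

/-- The `i`-th row `R_i` of the standard row-reading tableau of shape `ν`; here the set
`{1, …, r}` is replaced by `Fin r = {0, …, r - 1}`. -/
def Weight.row (ν : Weight m n r) (i : Fin (m + n)) : Finset (Fin r) :=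
  Finset.univ.filter fun k =>
    ∑ j ∈ Finset.Iio i, ν.1 j ≤ (k : ℕ) ∧ (k : ℕ) < ∑ j ∈ Finset.Iic i, ν.1 j

/-! ### The symmetric group and its parabolic subgroups -/

/-- The length of a permutation, as its number of inversions. -/
def len (w : Equiv.Perm (Fin r)) : ℕ :=
  (Finset.univ.filter fun p : Fin r × Fin r => p.1 < p.2 ∧ w p.2 < w p.1).card

/-- The Young subgroup of `lam|mu`: the permutations that preserve every row. -/
def young (ν : Weight m n r) : Subgroup (Equiv.Perm (Fin r)) where
  carrier := {w | ∀ i k, w k ∈ ν.row i ↔ k ∈ ν.row i}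
  one_mem' := fun _ _ => Iff.rfl
  mul_mem' := fun {a b} ha hb i k => (ha i (b k)).trans (hb i k)
  inv_mem' := fun {a} ha i k => by
    have := ha i (a⁻¹ k)
    rw [Equiv.Perm.coe_inv, Equiv.apply_symm_apply] at this
    exact this.symm

/-- The elements of the Young subgroup of `ν` that fix every entry of every row of parity `≠ e`.
For `ν = lam|mu` this is the Young subgroup of `lam ∨ (1, …, 1)` when `e = 0`
and that of `(1, …, 1) ∨ mu` when `e = 1`. -/
def youngPart (e : ZMod 2) (ν : Weight m n r) : Subgroup (Equiv.Perm (Fin r)) where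
  carrier := {w | w ∈ young ν ∧ ∀ i, hat m n i ≠ e → ∀ k ∈ ν.row i, w k = k}
  one_mem' := ⟨one_mem _, fun _ _ _ _ => rfl⟩
  mul_mem' := fun {a b} ha hb => ⟨mul_mem ha.1 hb.1, fun i hi k hk => by
    rw [Equiv.Perm.mul_apply, hb.2 i hi k hk, ha.2 i hi k hk]⟩
  inv_mem' := fun {a} ha => ⟨inv_mem ha.1, fun i hi k hk => by
    rw [Equiv.Perm.inv_eq_iff_eq, ha.2 i hi k hk]⟩

/-- The elements `d` of minimal length in their coset `W d`. -/
def minReps (W : Subgroup (Equiv.Perm (Fin r))) : Set (Equiv.Perm (Fin r)) :=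
  {d | ∀ w ∈ W, len d ≤ len (w * d)}

/-- The elements `d` with `d` minimal in `S_ν d` and `d⁻¹` minimal in `S_ρ d⁻¹`, i.e. the
shortest representatives of the double cosets `S_ν \ S_r / S_ρ`. -/
def minDoubleReps (ν ρ : Weight m n r) : Set (Equiv.Perm (Fin r)) :=
  {d | d ∈ minReps (young ν) ∧ d⁻¹ ∈ minReps (young ρ)}

/-- The entries `|R_i^ν ∩ w R_j^ρ|` of the matrix attached to `(ν, w, ρ)`. -/
def jmat (ν : Weight m n r) (w : Equiv.Perm (Fin r)) (ρ : Weight m n r) :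
    Matrix (Fin (m + n)) (Fin (m + n)) ℕ :=
  fun i j => (ν.row i ∩ (ρ.row j).image w).card

/-! Every matrix comes from a shortest double coset representative. -/

lemma Weight.sum_Iic (ν : Weight m n r) (i : Fin (m + n)) :
    ∑ j ∈ Finset.Iic i, ν.1 j = ∑ j ∈ Finset.Iio i, ν.1 j + ν.1 i := by
  rw [← Finset.Iio_insert, Finset.sum_insert (by simp), add_comm]

lemma Weight.sum_Iic_le (ν : Weight m n r) (i : Fin (m + n)) :
    ∑ j ∈ Finset.Iic i, ν.1 j ≤ r := by
  conv_rhs => rw [← ν.2]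
  exact Finset.sum_le_sum_of_subset (Finset.subset_univ _)

lemma Weight.card_row (ν : Weight m n r) (i : Fin (m + n)) : (ν.row i).card = ν.1 i := by
  have h : (ν.row i).map Fin.valEmbedding =
      Finset.Ico (∑ j ∈ Finset.Iio i, ν.1 j) (∑ j ∈ Finset.Iic i, ν.1 j) := by
    ext k
    simp only [Weight.row, Finset.mem_map, Finset.mem_filter, Finset.mem_univ, true_and,
      Fin.valEmbedding_apply, Finset.mem_Ico]
    constructor
    · rintro ⟨a, ha, rfl⟩
      exact ha
    · intro hk
      exact ⟨⟨k, lt_of_lt_of_le hk.2 (ν.sum_Iic_le i)⟩, hk, rfl⟩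
  rw [← Finset.card_map, h, Nat.card_Ico, ν.sum_Iic]
  omega

lemma Weight.exists_row (ν : Weight m n r) (k : Fin r) : ∃ i, k ∈ ν.row i := by
  by_contra hc
  push Not at hc
  have key : ∀ a : ℕ, ∀ ha : a < m + n, ∑ j ∈ Finset.Iic (⟨a, ha⟩ : Fin (m + n)), ν.1 j ≤ k := by
    intro a
    induction a with
    | zero =>
      intro ha
      have h := hc ⟨0, ha⟩
      simp only [Weight.row, Finset.mem_filter, Finset.mem_univ, true_and, not_and, not_lt] at h
      apply h
      have : Finset.Iio (⟨0, ha⟩ : Fin (m + n)) = ∅ := by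
        ext x; simp [Fin.lt_def]
      simp [this]
    | succ a ih =>
      intro ha
      have h := hc ⟨a + 1, ha⟩
      simp only [Weight.row, Finset.mem_filter, Finset.mem_univ, true_and, not_and, not_lt] at h
      apply h
      have : Finset.Iio (⟨a + 1, ha⟩ : Fin (m + n)) = Finset.Iic ⟨a, by omega⟩ := by
        ext x; simp only [Finset.mem_Iio, Finset.mem_Iic, Fin.lt_def, Fin.le_def]; omega
      rw [this]
      exact ih _
  rcases Nat.eq_zero_or_pos (m + n) with h0 | h0
  · have h1 : ∑ i, ν.1 i = 0 := Finset.sum_eq_zero fun i _ => absurd i.2 (by omega)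
    have := k.2
    have := ν.2
    omega
  · have h1 := key (m + n - 1) (by omega)
    have h2 : Finset.Iic (⟨m + n - 1, by omega⟩ : Fin (m + n)) = Finset.univ := by
      ext x; simp only [Finset.mem_Iic, Finset.mem_univ, iff_true, Fin.le_def]; omega
    rw [h2, ν.2] at h1
    have := k.2
    omega

lemma Weight.row_unique (ν : Weight m n r) {k : Fin r} {i j : Fin (m + n)}
    (hi : k ∈ ν.row i) (hj : k ∈ ν.row j) : i = j := by
  have aux : ∀ {i j : Fin (m + n)}, k ∈ ν.row i → k ∈ ν.row j → ¬ i < j := by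
    intro i j hi hj hlt
    simp only [Weight.row, Finset.mem_filter, Finset.mem_univ, true_and] at hi hj
    have : ∑ l ∈ Finset.Iic i, ν.1 l ≤ ∑ l ∈ Finset.Iio j, ν.1 l :=
      Finset.sum_le_sum_of_subset fun x hx => by
        simp only [Finset.mem_Iic, Finset.mem_Iio] at hx ⊢
        exact lt_of_le_of_lt hx hlt
    omega
  rcases lt_trichotomy i j with h | h | h
  · exact absurd h (aux hi hj)
  · exact h
  · exact absurd h (aux hj hi)

/-- A labelling of `{1, …, r}` that is compatible with the rows of `ν`. -/
lemma Weight.exists_equiv (ν : Weight m n r) {P : Type} [Fintype P] (g : P → Fin (m + n))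
    (hg : ∀ i, Fintype.card {p // g p = i} = ν.1 i) :
    ∃ e : Fin r ≃ P, ∀ k i, k ∈ ν.row i ↔ g (e k) = i := by
  classical
  choose b hb using ν.exists_row
  have hb' : ∀ k i, k ∈ ν.row i ↔ b k = i := fun k i =>
    ⟨fun h => ν.row_unique (hb k) h, fun h => h ▸ hb k⟩
  have hc : ∀ i, Nonempty ({k // b k = i} ≃ {p // g p = i}) := fun i => by
    rw [← Fintype.card_eq, hg, ← ν.card_row i, Fintype.card_subtype]
    congr 1
    ext k
    simp [hb']
  refine ⟨Equiv.ofFiberEquiv fun i => (hc i).some, fun k i => ?_⟩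
  rw [hb', Equiv.ofFiberEquiv_map (f := b) (g := g)]

lemma SMat.exists_jmat (A : SMat m n r) : ∃ w, jmat A.ro w A.co = A.1 := by
  classical
  let P : Type := Σ p : Fin (m + n) × Fin (m + n), Fin (A.1 p.1 p.2)
  obtain ⟨e, he⟩ := A.ro.exists_equiv (P := P) (fun p => p.1.1) fun i => by
    rw [Fintype.card_subtype, Finset.card_filter, Fintype.sum_sigma, Fintype.sum_prod_type]
    rw [Finset.sum_comm]
    simp [SMat.ro, apply_ite Finset.card]
  obtain ⟨f, hf⟩ := A.co.exists_equiv (P := P) (fun p => p.1.2) fun j => by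
    rw [Fintype.card_subtype, Finset.card_filter, Fintype.sum_sigma, Fintype.sum_prod_type]
    simp [SMat.co, apply_ite Finset.card]
  refine ⟨f.trans e.symm, ?_⟩
  ext i j
  have h1 : A.ro.row i ∩ (A.co.row j).image (f.trans e.symm) =
      (Finset.univ.filter fun p : P => p.1 = (i, j)).map e.symm.toEmbedding := by
    ext k
    simp only [Finset.mem_inter, Finset.mem_image, Finset.mem_map, Finset.mem_filter,
      Finset.mem_univ, true_and, he, hf, Equiv.trans_apply, Equiv.coe_toEmbedding]
    constructor
    · rintro ⟨h, a, ha, rfl⟩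
      rw [Equiv.apply_symm_apply] at h
      exact ⟨f a, Prod.ext h ha, rfl⟩
    · rintro ⟨p, hp, rfl⟩
      refine ⟨by rw [Equiv.apply_symm_apply, hp], f.symm p, by rw [Equiv.apply_symm_apply, hp], by
        rw [Equiv.apply_symm_apply]⟩
  rw [jmat, h1, Finset.card_map, Finset.card_filter, Fintype.sum_sigma]
  simp [apply_ite Finset.card]

lemma jmat_mul_left (ν ρ : Weight m n r) {x : Equiv.Perm (Fin r)} (hx : x ∈ young ν)
    (w : Equiv.Perm (Fin r)) : jmat ν (x * w) ρ = jmat ν w ρ := by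
  ext i j
  have : ν.row i ∩ (ρ.row j).image (x * w) = (ν.row i ∩ (ρ.row j).image w).map x.toEmbedding := by
    ext k
    simp only [Finset.mem_inter, Finset.mem_image, Finset.mem_map, Equiv.coe_toEmbedding,
      Equiv.Perm.mul_apply]
    constructor
    · rintro ⟨h, a, ha, rfl⟩
      exact ⟨w a, ⟨(hx i _).1 h, a, ha, rfl⟩, rfl⟩
    · rintro ⟨_, ⟨h, a, ha, rfl⟩, rfl⟩
      exact ⟨(hx i _).2 h, a, ha, rfl⟩
  rw [jmat, jmat, this, Finset.card_map]

lemma jmat_mul_right (ν ρ : Weight m n r) {x : Equiv.Perm (Fin r)} (hx : x ∈ young ρ)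
    (w : Equiv.Perm (Fin r)) : jmat ν (w * x) ρ = jmat ν w ρ := by
  ext i j
  have : (ρ.row j).image (w * x) = (ρ.row j).image w := by
    ext k
    simp only [Finset.mem_image, Equiv.Perm.mul_apply]
    constructor
    · rintro ⟨a, ha, rfl⟩
      exact ⟨x a, (hx j _).2 ha, rfl⟩
    · rintro ⟨a, ha, rfl⟩
      refine ⟨x⁻¹ a, (inv_mem hx j _).2 ha, by rw [Equiv.Perm.coe_inv, Equiv.apply_symm_apply]⟩
  rw [jmat, jmat, this]

lemma len_inv (w : Equiv.Perm (Fin r)) : len w⁻¹ = len w := by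
  unfold len
  refine Finset.card_bij (fun p _ => (w⁻¹ p.2, w⁻¹ p.1)) ?_ ?_ ?_
  · intro p hp
    simp only [Finset.mem_filter, Finset.mem_univ, true_and, Equiv.Perm.coe_inv, Equiv.apply_symm_apply] at hp ⊢
    exact ⟨hp.2, hp.1⟩
  · rintro ⟨a, b⟩ _ ⟨c, d⟩ _ h
    simp only [Prod.mk.injEq, EmbeddingLike.apply_eq_iff_eq] at h
    exact Prod.ext h.2 h.1
  · rintro ⟨a, b⟩ h
    simp only [Finset.mem_filter, Finset.mem_univ, true_and] at h
    refine ⟨(w b, w a), ?_, by simp⟩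
    simp only [Finset.mem_filter, Finset.mem_univ, true_and, Equiv.Perm.coe_inv, Equiv.symm_apply_apply]
    exact ⟨h.2, h.1⟩

lemma SMat.exists_rep (A : SMat m n r) :
    ∃ d, d ∈ minDoubleReps A.ro A.co ∧ jmat A.ro d A.co = A.1 := by
  classical
  obtain ⟨w, hw⟩ := A.exists_jmat
  obtain ⟨d, hd, hmin⟩ := Finset.exists_min_image
    (Finset.univ.filter fun w => jmat A.ro w A.co = A.1) len ⟨w, by simpa using hw⟩
  simp only [Finset.mem_filter, Finset.mem_univ, true_and] at hd hmin
  refine ⟨d, ⟨fun x hx => hmin _ (by rw [jmat_mul_left _ _ hx, hd]), fun x hx => ?_⟩, hd⟩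
  have := hmin (d * x⁻¹) (by rw [jmat_mul_right _ _ (inv_mem hx), hd])
  rw [len_inv, ← len_inv (x * d⁻¹), mul_inv_rev, inv_inv]
  exact this

/-- The shortest double coset representative `d` with `A = ȷ(ro A, d, co A)`. -/
def SMat.rep (A : SMat m n r) : Equiv.Perm (Fin r) := A.exists_rep.choose

/-! ### The Hecke algebra -/

section Algebra

set_option linter.unusedSimpArgs false

variable (r : ℕ) (R : Type*) [CommRing R] [Algebra ℤ[T;T⁻¹] R]

/-- The image `v` of the indeterminate in `R`, as a unit. -/
def vUnit : Rˣ :=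
  Units.map (algebraMap ℤ[T;T⁻¹] R : ℤ[T;T⁻¹] →* R)
    ⟨LaurentPolynomial.T 1, LaurentPolynomial.T (-1),
      by rw [← LaurentPolynomial.T_add]; simp, by rw [← LaurentPolynomial.T_add]; simp⟩

/-- `q = v ^ 2`. -/
def qUnit : Rˣ := vUnit R ^ 2

/-- The defining relations of the Hecke algebra, on generators `T_w`. -/
inductive HeckeRel : FreeAlgebra R (Equiv.Perm (Fin r)) → FreeAlgebra R (Equiv.Perm (Fin r)) → Prop
  | one : HeckeRel (FreeAlgebra.ι R 1) 1
  | sq (i j : Fin r) (hij : (j : ℕ) = i + 1) :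
      HeckeRel (FreeAlgebra.ι R (Equiv.swap i j) * FreeAlgebra.ι R (Equiv.swap i j))
        (((qUnit R : R) - 1) • FreeAlgebra.ι R (Equiv.swap i j) + (qUnit R : R) • 1)
  | mul (y w : Equiv.Perm (Fin r)) (hl : len (y * w) = len y + len w) :
      HeckeRel (FreeAlgebra.ι R y * FreeAlgebra.ι R w) (FreeAlgebra.ι R (y * w))

/-- The Hecke algebra `H_R` of the symmetric group on `r` letters. -/
def Hecke : Type _ := RingQuot (HeckeRel r R)

instance : Ring (Hecke r R) := inferInstanceAs (Ring (RingQuot (HeckeRel r R)))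

instance : Algebra R (Hecke r R) := inferInstanceAs (Algebra R (RingQuot (HeckeRel r R)))

variable {r}

/-- The element `T_w` of the Hecke algebra. -/
def heckeT (w : Equiv.Perm (Fin r)) : Hecke r R :=
  RingQuot.mkAlgHom R (HeckeRel r R) (FreeAlgebra.ι R w)

/-- The scalar `(-q) ^ (-k)`. -/
def negq (k : ℕ) : R := ((-qUnit R) ^ (-(k : ℤ)) : Rˣ)

open Classical in
/-- `x_lam`, for the weight `ν = lam|mu`. -/
def xElt (ν : Weight m n r) : Hecke r R :=
  ∑ w ∈ Finset.univ.filter (fun w => w ∈ youngPart 0 ν), heckeT R w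

open Classical in
/-- `y_mu`, for the weight `ν = lam|mu`. -/
def yElt (ν : Weight m n r) : Hecke r R :=
  ∑ w ∈ Finset.univ.filter (fun w => w ∈ youngPart 1 ν), negq R (len w) • heckeT R w

/-- `x_lam y_mu`. -/
def xyElt (ν : Weight m n r) : Hecke r R := xElt R ν * yElt R ν

/-- The right ideal `x_lam y_mu H_R` of `H_R`, i.e. the right submodule generated by
`x_lam y_mu`. -/
abbrev signedIdeal (ν : Weight m n r) : Submodule (Hecke r R)ᵐᵒᵖ (Hecke r R) :=
  Submodule.span (Hecke r R)ᵐᵒᵖ {xyElt R ν}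

/-- The signed `q`-permutation module `x_lam y_mu H_R`; right `H_R`-modules are modules over the
opposite algebra. -/
def SignedPerm (ν : Weight m n r) : Type _ := signedIdeal R ν

instance (ν : Weight m n r) : AddCommGroup (SignedPerm R ν) :=
  inferInstanceAs (AddCommGroup (signedIdeal R ν))

instance (ν : Weight m n r) : Module (Hecke r R)ᵐᵒᵖ (SignedPerm R ν) :=
  inferInstanceAs (Module (Hecke r R)ᵐᵒᵖ (signedIdeal R ν))

instance (ν : Weight m n r) : Module R (SignedPerm R ν) :=
  inferInstanceAs (Module R (signedIdeal R ν))

instance (ν : Weight m n r) : IsScalarTower R (Hecke r R)ᵐᵒᵖ (SignedPerm R ν) :=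
  inferInstanceAs (IsScalarTower R (Hecke r R)ᵐᵒᵖ (signedIdeal R ν))

instance (ν : Weight m n r) : SMulCommClass (Hecke r R)ᵐᵒᵖ R (SignedPerm R ν) :=
  inferInstanceAs (SMulCommClass (Hecke r R)ᵐᵒᵖ R (signedIdeal R ν))

variable {R} in
/-- The inclusion of `x_lam y_mu H_R` into `H_R`. -/
def SignedPerm.val {ν : Weight m n r} : SignedPerm R ν →ₗ[(Hecke r R)ᵐᵒᵖ] Hecke r R where
  toFun x := x.1
  map_add' _ _ := rfl
  map_smul' _ _ := rfl

/-- The element `x_lam y_mu h` of `x_lam y_mu H_R`. -/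
def SignedPerm.mk (ν : Weight m n r) (h : Hecke r R) : SignedPerm R ν :=
  ⟨xyElt R ν * h, Submodule.mem_span_singleton.2 ⟨MulOpposite.op h, rfl⟩⟩

/-- The subgroup `d⁻¹ S_ν^e d ∩ S_ρ^e`, where `ν`, `ρ` are the row and column sums of `A`, the
element `d` is the shortest representative of the double coset of `A`, and `S_ν^e` is the part of
the Young subgroup of parity `e`. -/
def SMat.interPart (e : ZMod 2) (A : SMat m n r) : Subgroup (Equiv.Perm (Fin r)) :=
  (youngPart e A.ro).map (MulAut.conj A.rep⁻¹).toMonoidHom ⊓ youngPart e A.co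

open Classical in
/-- `T_D = ∑ (-q)^(-l(v)) x_lam y_mu T_d T_u T_v`, the sum over all `u`, `v` in the even and the
odd part of the Young subgroup of the column sums for which `u v` is of minimal length in its
right coset with respect to the subgroup `d⁻¹ S_{lam|mu} d ∩ S_{xi|eta}`. -/
def SMat.TD (A : SMat m n r) : Hecke r R :=
  ∑ p ∈ Finset.univ.filter (fun p : Equiv.Perm (Fin r) × Equiv.Perm (Fin r) =>
      p.1 ∈ youngPart 0 A.co ∧ p.2 ∈ youngPart 1 A.co ∧
        p.1 * p.2 ∈ minReps (A.interPart 0 ⊔ A.interPart 1)),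
    negq R (len p.2) • (xyElt R A.ro * heckeT R A.rep * heckeT R p.1 * heckeT R p.2)

/-! ### The quantum Schur superalgebra -/

variable (m n r)

/-- The direct sum of all the modules `x_lam y_mu H_R`, over the finite set of weights. -/
abbrev TSpace : Type _ := ∀ ν : Weight m n r, SignedPerm R ν

/-- The algebra `End_{H_R}(⨁ x_lam y_mu H_R)`, under composition. -/
abbrev EndH : Type _ := Module.End (Hecke r R)ᵐᵒᵖ (TSpace m n r R)

/-- The projection of `⨁ x_lam y_mu H_R` onto its part of degree `e`, the sum of the
`x_lam y_mu H_R` with `|mu| ≡ e`. -/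
def proj (e : ZMod 2) : EndH m n r R :=
  LinearMap.pi fun ν => if ν.parity = e then LinearMap.proj ν else 0

variable {m n r R}

/-- The component of degree `i` of an endomorphism: its part in the sum of the modules
`Hom(x_xi y_eta H_R, x_lam y_mu H_R)` with `|mu| + |eta| ≡ i`. -/
def homog (i : ZMod 2) (f : EndH m n r R) : EndH m n r R :=
  ∑ e : ZMod 2, proj m n r R (e + i) * f * proj m n r R e

/-- The sign `(-1)^(ij)`. -/
def superSign (i j : ZMod 2) : ℤ := if i = 1 ∧ j = 1 then -1 else 1

variable (m n r R)

/-- The quantum Schur superalgebra: the `R`-module `End_{H_R}(⨁ x_lam y_mu H_R)`, whose product is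
the supermultiplication below instead of composition. -/
def QSchur : Type _ := EndH m n r R

instance : AddCommGroup (QSchur m n r R) := inferInstanceAs (AddCommGroup (EndH m n r R))

instance : Module R (QSchur m n r R) := inferInstanceAs (Module R (EndH m n r R))

variable {m n r R}

/-- An element of the quantum Schur superalgebra as an endomorphism. -/
def QSchur.toEnd : QSchur m n r R ≃ₗ[R] EndH m n r R :=
  LinearEquiv.refl R (EndH m n r R)

/-- The supermultiplication: `(-1)^(ij)` times composition on elements of degrees `i`, `j`. -/
instance : Mul (QSchur m n r R) :=
  ⟨fun f g => QSchur.toEnd.symm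
    (∑ i : ZMod 2, ∑ j : ZMod 2, superSign i j • (homog i f.toEnd * homog j g.toEnd))⟩

instance : One (QSchur m n r R) := ⟨QSchur.toEnd.symm 1⟩

/-! The supermultiplication makes this an associative algebra. -/

lemma proj_mul_proj : proj m n r R 0 * proj m n r R 0 = proj m n r R 0 := by
  refine LinearMap.ext fun x => funext fun ν => ?_
  by_cases h : ν.parity = 0 <;> simp [proj, h]

lemma proj_one_eq : proj m n r R 1 = 1 - proj m n r R 0 := by
  refine LinearMap.ext fun x => funext fun ν => ?_
  have h2 : ∀ a : ZMod 2, a = 0 ∨ a = 1 := by decide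
  rcases h2 ν.parity with h | h <;> simp [proj, h]

lemma homog_one (f : EndH m n r R) : homog 1 f =
    (1 - proj m n r R 0) * f * proj m n r R 0 + proj m n r R 0 * f * (1 - proj m n r R 0) := by
  have : (1 + 1 : ZMod 2) = 0 := by decide
  rw [← proj_one_eq, homog, show (Finset.univ : Finset (ZMod 2)) = {0, 1} from rfl,
    Finset.sum_pair (by decide), zero_add, this]

lemma homog_zero (f : EndH m n r R) : homog 0 f = f - homog 1 f := by
  rw [homog_one, homog, show (Finset.univ : Finset (ZMod 2)) = {0, 1} from rfl,
    Finset.sum_pair (by decide), zero_add, add_zero, proj_one_eq]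
  simp only [mul_add, add_mul, mul_sub, sub_mul, one_mul, mul_one, mul_assoc]; abel

lemma homog_add (f g : EndH m n r R) : homog 1 (f + g) = homog 1 f + homog 1 g := by
  simp only [homog_one]; simp only [mul_add, add_mul, mul_sub, sub_mul, one_mul, mul_one, mul_assoc]; abel

lemma homog_sub (f g : EndH m n r R) : homog 1 (f - g) = homog 1 f - homog 1 g := by
  simp only [homog_one]; simp only [mul_add, add_mul, mul_sub, sub_mul, one_mul, mul_one, mul_assoc]; abel

lemma homog_smul (c : R) (f : EndH m n r R) : homog 1 (c • f) = c • homog 1 f := by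
  simp only [homog_one, mul_smul_comm, smul_mul_assoc, smul_add]

lemma homog_one_one : homog 1 (1 : EndH m n r R) = 0 := by
  rw [homog_one, mul_one, mul_one, sub_mul, mul_sub, proj_mul_proj, one_mul, mul_one, sub_self,
    add_zero]

lemma homog_homog (f : EndH m n r R) : homog 1 (homog 1 f) = homog 1 f := by
  have h2 : ∀ x, proj m n r R 0 * (proj m n r R 0 * x) = proj m n r R 0 * x := fun x => by
    rw [← mul_assoc, proj_mul_proj]
  simp only [homog_one, mul_add, add_mul, mul_sub, sub_mul, mul_one, one_mul, mul_assoc, h2,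
    proj_mul_proj]
  abel

lemma homog_mul (f g : EndH m n r R) :
    homog 1 (f * g) = homog 1 f * (g - homog 1 g) + (f - homog 1 f) * homog 1 g := by
  have h2 : ∀ x, proj m n r R 0 * (proj m n r R 0 * x) = proj m n r R 0 * x := fun x => by
    rw [← mul_assoc, proj_mul_proj]
  simp only [homog_one, mul_add, add_mul, mul_sub, sub_mul, mul_one, one_mul, mul_assoc, h2]
  abel

lemma QSchur.toEnd_mul (f g : QSchur m n r R) : (f * g).toEnd =
    f.toEnd * g.toEnd - (homog 1 f.toEnd * homog 1 g.toEnd +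
      homog 1 f.toEnd * homog 1 g.toEnd) := by
  change ∑ i : ZMod 2, ∑ j : ZMod 2, superSign i j • (homog i f.toEnd * homog j g.toEnd) = _
  simp only [show (Finset.univ : Finset (ZMod 2)) = {0, 1} from rfl,
    Finset.sum_pair (show (0 : ZMod 2) ≠ 1 by decide), superSign, homog_zero]
  simp only [show ((0 : ZMod 2) = 1) = False by simp, and_false, false_and, and_true, if_false,
    if_true, one_smul, neg_smul]
  simp only [mul_sub, sub_mul]
  abel

lemma QSchur.toEnd_one : (1 : QSchur m n r R).toEnd = 1 := rfl

instance : Ring (QSchur m n r R) :=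
  { (inferInstance : AddCommGroup (QSchur m n r R)),
    (inferInstance : Mul (QSchur m n r R)),
    (inferInstance : One (QSchur m n r R)) with
    left_distrib := fun a b c => QSchur.toEnd.injective <| by
      simp only [QSchur.toEnd_mul, map_add, homog_add]; simp only [mul_add, add_mul, mul_sub, sub_mul, one_mul, mul_one, mul_assoc]; abel
    right_distrib := fun a b c => QSchur.toEnd.injective <| by
      simp only [QSchur.toEnd_mul, map_add, homog_add]; simp only [mul_add, add_mul, mul_sub, sub_mul, one_mul, mul_one, mul_assoc]; abel
    zero_mul := fun a => QSchur.toEnd.injective <| by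
      simp [QSchur.toEnd_mul, homog_one]
    mul_zero := fun a => QSchur.toEnd.injective <| by
      simp [QSchur.toEnd_mul, homog_one]
    one_mul := fun a => QSchur.toEnd.injective <| by
      simp [QSchur.toEnd_mul, QSchur.toEnd_one, homog_one_one]
    mul_one := fun a => QSchur.toEnd.injective <| by
      simp [QSchur.toEnd_mul, QSchur.toEnd_one, homog_one_one]
    mul_assoc := fun a b c => QSchur.toEnd.injective <| by
      simp only [QSchur.toEnd_mul, homog_add, homog_sub, homog_mul, homog_homog]
      simp only [mul_add, add_mul, mul_sub, sub_mul, one_mul, mul_one, mul_assoc]; abel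
    zsmul := fun k a => k • a
    zsmul_zero' := SubNegMonoid.zsmul_zero'
    zsmul_succ' := SubNegMonoid.zsmul_succ'
    zsmul_neg' := SubNegMonoid.zsmul_neg' }

instance : Algebra R (QSchur m n r R) :=
  Algebra.ofModule
    (fun c f g => QSchur.toEnd.injective <| by
      simp only [QSchur.toEnd_mul, map_smul, homog_smul, smul_mul_assoc, smul_sub, smul_add])
    (fun c f g => QSchur.toEnd.injective <| by
      simp only [QSchur.toEnd_mul, map_smul, homog_smul, mul_smul_comm, smul_sub, smul_add])

/-! ### The standard basis -/

open Classical in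
/-- The defining property of `phi_A`: it sends `x_al y_be h` to `T_D h` in `x_lam y_mu H_R` if
`al|be` is the vector of column sums of `A`, and to `0` otherwise; here `lam|mu` is the vector of
row sums of `A` and `D` is the double coset of `A`. -/
def IsPhi (A : SMat m n r) (f : QSchur m n r R) : Prop :=
  ∀ (ν κ : Weight m n r) (h : Hecke r R),
    (f.toEnd (Pi.single ν (SignedPerm.mk R ν h)) κ).val =
      if ν = A.co ∧ κ = A.ro then A.TD R * h else 0

instance : Finite (Weight m n r) :=
  Finite.of_injective
    (fun ν i => (⟨ν.1 i, Nat.lt_succ_of_le ((Finset.single_le_sum (fun _ _ => Nat.zero_le _)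
      (Finset.mem_univ i)).trans_eq ν.2)⟩ : Fin (r + 1)))
    fun _ _ h => Subtype.ext <| funext fun i => congrArg Fin.val (congrFun h i)

/-- The defining property determines `phi_A`. -/
lemma IsPhi.unique {A : SMat m n r} {f g : QSchur m n r R} (hf : IsPhi A f) (hg : IsPhi A g) :
    f = g := by
  classical
  have := Fintype.ofFinite (Weight m n r)
  refine QSchur.toEnd.injective (LinearMap.pi_ext fun ν x => ?_)
  obtain ⟨h, hx⟩ := Submodule.mem_span_singleton.1 x.2
  obtain rfl : x = SignedPerm.mk R ν h.unop := Subtype.ext hx.symm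
  funext κ
  refine Subtype.ext ?_
  have h1 := (hf ν κ h.unop).trans (hg ν κ h.unop).symm
  convert h1 using 1 <;> rfl

variable (R) in
/-- The element `phi_A`, i.e. the only element with the property `IsPhi A`. -/
def phi (A : SMat m n r) : QSchur m n r R := Classical.epsilon (IsPhi A)

end Algebra

end QSS

end

/-! A homomorphism out of the cyclic module `x_ν y_ν H` is determined by its value on the generator,
so an endomorphism of the direct sum is a matrix of elements of the Hecke algebra (`entry`). For an
adjacent transposition `s` inside a row of `ν`, left multiplication by `T_s` scales `x_ν y_ν` by `q`
on even rows and by `-1` on odd rows. On coefficients this says that the one at `s w` is `1`,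
respectively `-q⁻¹`, times the one at `w` whenever `s w` is longer (`leftSgn_iff`). An element with
this property is fixed by its coefficients at the shortest coset representatives, and these can be
prescribed freely, so over every `R` the property cuts out exactly `x_ν y_ν H`
(`LeftSgn.exists_eq_mul`). Together with the anti-automorphism `T_w ↦ T_(w⁻¹)`, this identifies each
Hom space with the set of `h` that have the property on both sides (`leftSgn_entry`,
`leftSgn_heckeInv_entry`, `exists_entry_eq`).

Existence of `phi_A`: the sum of `(-q)^(-stat w) T_w` over the double coset of `A` has the property
on both sides. Indeed `stat` is invariant under inversion, and a lengthening multiplication by `s`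
raises it by one exactly when the row of `s` is odd; this uses that entries of `A` at odd positions
are at most `1` (`stat_mul_swap`). The sum is the element of the definition (`SMat.TD_eq`), and its
coefficient at the shortest representative is `1`, which gives independence.

Spanning: a two-sided `h` is determined by its coefficients at shortest double coset representatives
`w`. If the matrix of `w` has an entry at least `2` at an odd position, there are transpositions
`s`, `t` in rows of opposite parity with `s w = w t`. Computing the coefficient there in both ways
gives `c = -q⁻¹ c`, that is `(1 + q) c = 0`, so `c = 0` when `1 + q` is not a zero divisor. For `m =
0`, `n = 0` or `r ≤ 1` no such `w` exists (`eq_zero_of_coef_rep`).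

Base change acts on entries through the map of Hecke algebras, and the anti-involution transposes
the matrix of entries while inverting each `T_w`. Products follow from the formula for the entries
of a composition, since the supermultiplication is composition corrected by twice the product of the
odd parts. -/

namespace QSS

open Equiv

/-! ### Inversions with a given property -/

section Inversions

variable {r : ℕ}

/-- The pair `i, j` of consecutive points. -/
abbrev Adj (i j : Fin r) : Prop := (j : ℕ) = i + 1

lemma Adj.lt {i j : Fin r} (h : Adj i j) : i < j := Fin.lt_def.2 (by rw [h]; omega)

/-- A transposition of consecutive points changes the order of no other pair. -/
lemma Adj.swap_lt_swap {i j : Fin r} (h : Adj i j) {a b : Fin r} (hab : a < b)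
    (hne : ¬(a = i ∧ b = j)) : swap i j a < swap i j b := by
  simp only [Fin.lt_def, Fin.ext_iff, swap_apply_def] at *
  split_ifs <;> omega

lemma Adj.swap_lt_swap_iff {i j : Fin r} (h : Adj i j) {a b : Fin r}
    (hne : ¬(a = i ∧ b = j)) (hne' : ¬(a = j ∧ b = i)) : swap i j a < swap i j b ↔ a < b := by
  refine ⟨fun hab => ?_, fun hab => h.swap_lt_swap hab hne⟩
  have := h.swap_lt_swap hab fun hc => hne'
    ⟨by simpa using congrArg (swap i j) hc.1, by simpa using congrArg (swap i j) hc.2⟩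
  simpa using this

/-- The number of inversions `p, q` of `w` with `Q p q`. -/
noncomputable def cnt (Q : Fin r → Fin r → Prop) (w : Perm (Fin r)) : ℕ :=
  {p : Fin r × Fin r | (p.1 < p.2 ∧ w p.2 < w p.1) ∧ Q p.1 p.2}.ncard

lemma cnt_true (w : Perm (Fin r)) : cnt (fun _ _ => True) w = len w := by
  rw [cnt, len, ← Set.ncard_coe_finset]
  simp

lemma cnt_congr {Q Q' : Fin r → Fin r → Prop} {w w' : Perm (Fin r)}
    (h : ∀ p q, p < q → ((w q < w p ∧ Q p q) ↔ (w' q < w' p ∧ Q' p q))) :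
    cnt Q w = cnt Q' w' := by
  unfold cnt
  congr 1
  ext ⟨p, q⟩
  simp only [Set.mem_ofPred_eq, and_assoc]
  exact ⟨fun hx => ⟨hx.1, (h p q hx.1).1 hx.2⟩, fun hx => ⟨hx.1, (h p q hx.1).2 hx.2⟩⟩

lemma cnt_eq_zero {Q : Fin r → Fin r → Prop} {w : Perm (Fin r)}
    (h : ∀ p q, p < q → Q p q → w p < w q) : cnt Q w = 0 := by
  rw [cnt, Set.ncard_eq_zero, Set.eq_empty_iff_forall_notMem]
  rintro ⟨p, q⟩ ⟨⟨h1, h2⟩, h3⟩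
  exact absurd (h p q h1 h3) h2.asymm

lemma cnt_add (Q Q' : Fin r → Fin r → Prop) (w : Perm (Fin r)) :
    cnt (fun p q => Q p q ∧ Q' p q) w + cnt (fun p q => Q p q ∧ ¬Q' p q) w = cnt Q w := by
  unfold cnt
  rw [← Set.ncard_union_eq]
  · congr 1
    ext ⟨p, q⟩
    simp only [Set.mem_union, Set.mem_ofPred_eq]
    tauto
  · rw [Set.disjoint_left]
    rintro ⟨p, q⟩ h h'
    exact h'.2.2 h.2.2

/-- The inversions of `w d` and those of `w`, where `d` maps the pairs with property `Q` to those
with property `Q'`, without changing their order. -/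
lemma cnt_comp {Q Q' : Fin r → Fin r → Prop} {w d : Perm (Fin r)}
    (hQ : ∀ p q, Q p q ↔ Q' (d p) (d q)) (hd : ∀ p q, p ≠ q → Q p q → (p < q ↔ d p < d q)) :
    cnt Q (w * d) = cnt Q' w := by
  unfold cnt
  refine Set.ncard_congr (fun p _ => (d p.1, d p.2)) ?_ ?_ ?_
  · rintro ⟨p, q⟩ h
    exact ⟨⟨(hd _ _ h.1.1.ne h.2).1 h.1.1, h.1.2⟩, (hQ _ _).1 h.2⟩
  · rintro ⟨p, q⟩ ⟨p', q'⟩ _ _ h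
    simpa using h
  · rintro ⟨p, q⟩ h
    have h2 : Q (d⁻¹ p) (d⁻¹ q) := (hQ _ _).2 (by simpa using h.2)
    exact ⟨(d⁻¹ p, d⁻¹ q), ⟨⟨(hd _ _ (by simpa using h.1.1.ne) h2).2 (by simpa using h.1.1),
      by simpa using h.1.2⟩, h2⟩, by simp⟩

/-- An inversion of `w⁻¹` is the image under `w` of an inversion of `w` with its two points
exchanged, hence the reversed arguments of `Q`. -/
lemma cnt_inv (Q : Fin r → Fin r → Prop) (w : Perm (Fin r)) :
    cnt Q w⁻¹ = cnt (fun p q => Q (w q) (w p)) w := by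
  unfold cnt
  refine Set.ncard_congr (fun p _ => (w⁻¹ p.2, w⁻¹ p.1)) ?_ ?_ ?_
  · rintro ⟨p, q⟩ h
    exact ⟨⟨h.1.2, by simpa using h.1.1⟩, by simpa using h.2⟩
  · rintro ⟨p, q⟩ ⟨p', q'⟩ _ _ h
    simp only [Prod.mk.injEq, EmbeddingLike.apply_eq_iff_eq] at h
    exact Prod.ext h.2 h.1
  · rintro ⟨p, q⟩ h
    exact ⟨(w q, w p), ⟨⟨h.1.2, by simpa using h.1.1⟩, by simpa using h.2⟩, by simp⟩

-- The transposition matches the inversions other than `(i, j)` on both sides without changing their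
-- order. The pair `(i, j)` itself becomes a new inversion, and `Q' i j` means `Q j i`.
open Classical in
lemma cnt_mul_swap {Q Q' : Fin r → Fin r → Prop} {i j : Fin r} (hij : Adj i j)
    {w : Perm (Fin r)} (h : w i < w j) (hQ : ∀ p q, Q' p q ↔ Q (swap i j p) (swap i j q)) :
    cnt Q' (w * swap i j) = cnt Q w + if Q j i then 1 else 0 := by
  rw [← cnt_add Q' (fun p q => ¬(p = i ∧ q = j))]
  congr 1
  · rw [← cnt_add Q (fun p q => ¬(p = i ∧ q = j)),
      cnt_eq_zero (Q := fun p q => Q p q ∧ ¬¬(p = i ∧ q = j)), add_zero]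
    -- Excluding `(j, i)` as well changes no count, since only pairs with `p < q` matter, but it
    -- makes the condition stable under the transposition, as `cnt_comp` requires.
    · rw [cnt_congr (Q' := fun p q => Q' p q ∧ ¬(p = i ∧ q = j) ∧ ¬(p = j ∧ q = i))
          (w' := w * swap i j), cnt_congr (Q := fun p q => Q p q ∧ ¬(p = i ∧ q = j))
          (Q' := fun p q => Q p q ∧ ¬(p = i ∧ q = j) ∧ ¬(p = j ∧ q = i)) (w' := w)]
      · refine cnt_comp (fun p q => ?_) fun p q _ hpq => (hij.swap_lt_swap_iff hpq.2.1 hpq.2.2).symm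
        have e1 : ∀ a, swap i j a = i ↔ a = j := fun a => by
          rw [← (swap i j).injective.eq_iff, swap_apply_self, swap_apply_left]
        have e2 : ∀ a, swap i j a = j ↔ a = i := fun a => by
          rw [← (swap i j).injective.eq_iff, swap_apply_self, swap_apply_right]
        rw [hQ, e1, e1, e2, e2]
        tauto
      · intro p q hpq
        have : ¬(p = j ∧ q = i) := fun hc => by
          rw [hc.1, hc.2] at hpq; exact hpq.asymm hij.lt
        tauto
      · intro p q hpq
        have : ¬(p = j ∧ q = i) := fun hc => by
          rw [hc.1, hc.2] at hpq; exact hpq.asymm hij.lt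
        tauto
    · rintro p q - ⟨-, hc⟩
      rw [not_not] at hc
      rw [hc.1, hc.2]
      exact h
  · have e : Q j i ↔ Q' i j := by rw [hQ]; simp
    rw [e]
    split_ifs with hc
    · rw [cnt, Set.ncard_eq_one]
      refine ⟨(i, j), ?_⟩
      ext ⟨p, q⟩
      simp only [not_not, Set.mem_ofPred_eq, Set.mem_singleton_iff, Prod.mk.injEq]
      refine ⟨fun hx => hx.2.2, ?_⟩
      rintro ⟨rfl, rfl⟩
      exact ⟨⟨hij.lt, by simpa using h⟩, hc, rfl, rfl⟩
    · refine cnt_eq_zero fun p q _ h2 => absurd h2.1 ?_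
      rw [(not_not.1 h2.2).1, (not_not.1 h2.2).2]
      exact hc

lemma len_mul_swap {i j : Fin r} (hij : Adj i j) {w : Perm (Fin r)} (h : w i < w j) :
    len (w * swap i j) = len w + 1 := by
  classical
  rw [← cnt_true, ← cnt_true, cnt_mul_swap (Q := fun _ _ => True) hij h (by simp), if_pos trivial]

lemma len_mul_swap' {i j : Fin r} (hij : Adj i j) {w : Perm (Fin r)} (h : w j < w i) :
    len (w * swap i j) + 1 = len w := by
  rw [← len_mul_swap hij (by simpa using h), mul_assoc, swap_mul_self, mul_one]

lemma len_swap_mul {i j : Fin r} (hij : Adj i j) {w : Perm (Fin r)} (h : w⁻¹ i < w⁻¹ j) :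
    len (swap i j * w) = len w + 1 := by
  rw [← len_inv, mul_inv_rev, swap_inv, len_mul_swap hij h, len_inv]

lemma len_swap_mul' {i j : Fin r} (hij : Adj i j) {w : Perm (Fin r)} (h : w⁻¹ j < w⁻¹ i) :
    len (swap i j * w) + 1 = len w := by
  rw [← len_inv, mul_inv_rev, swap_inv, len_mul_swap' hij h, len_inv]

lemma len_one : len (1 : Perm (Fin r)) = 0 := by
  rw [← cnt_true]
  exact cnt_eq_zero fun p q h _ => h

lemma len_swap {i j : Fin r} (hij : Adj i j) : len (swap i j) = 1 := by
  have := len_mul_swap (w := 1) hij hij.lt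
  rwa [one_mul, len_one] at this

/-- A function that increases along all pairs of consecutive points of an interval. -/
lemma lt_of_adj {α : Type*} [Preorder α] (f : Fin r → α) {a b : Fin r} (hab : a < b)
    (h : ∀ i j, Adj i j → a ≤ i → j ≤ b → f i < f j) : f a < f b := by
  obtain ⟨a, ha⟩ := a
  obtain ⟨b, hb⟩ := b
  simp only [Fin.lt_def] at hab
  induction b, hab using Nat.le_induction with
  | base => exact h _ _ rfl le_rfl le_rfl
  | succ b hab ih =>
    refine (ih (by omega) fun i j hij hi hj => h i j hij hi (hj.trans ?_)).trans
      (h _ _ rfl ?_ le_rfl)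
    · simp [Fin.le_def]
    · simp only [Fin.le_def]; simp only [Nat.succ_eq_add_one] at hab; omega

/-- A permutation without descents is increasing, and the identity is the only increasing one. -/
lemma exists_descent {w : Perm (Fin r)} (hw : w ≠ 1) : ∃ i j : Fin r, Adj i j ∧ w j < w i := by
  by_contra! hc
  have hmono : StrictMono w := fun a b hab => lt_of_adj w hab fun i j hij _ _ =>
    lt_of_le_of_ne (hc i j hij) fun he => hij.lt.ne (w.injective he)
  have := Tuple.unique_monotone (f := (id : Fin r → Fin r)) (σ := w) (τ := 1) hmono.monotone
    monotone_id
  exact hw (Equiv.ext fun a => congrFun this a)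

lemma eq_one_of_len {w : Perm (Fin r)} (hw : len w = 0) : w = 1 := by
  by_contra hne
  obtain ⟨i, j, hij, h⟩ := exists_descent hne
  have := len_mul_swap' hij h
  omega

/-- Induction along reduced expressions, multiplying on the left. -/
lemma left_induction {P : Perm (Fin r) → Prop} (one : P 1)
    (mul : ∀ i j w, Adj i j → w⁻¹ i < w⁻¹ j → P w → P (swap i j * w)) (w : Perm (Fin r)) : P w := by
  induction hn : len w generalizing w with
  | zero => rwa [eq_one_of_len hn]
  | succ k ih =>
    have hne : w⁻¹ ≠ 1 := fun hc => by
      rw [inv_eq_one.1 hc, len_one] at hn; omega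
    obtain ⟨i, j, hij, h⟩ := exists_descent hne
    have := mul i j (swap i j * w) hij (by simpa using h)
      (ih _ (by have := len_swap_mul' hij h; omega))
    rwa [← mul_assoc, swap_mul_self, one_mul] at this

lemma right_induction {P : Perm (Fin r) → Prop} (one : P 1)
    (mul : ∀ i j w, Adj i j → w i < w j → P w → P (w * swap i j)) (w : Perm (Fin r)) : P w := by
  have := left_induction (P := fun w => P w⁻¹) (by simpa using one)
    (fun i j w hij h hw => by
      rw [mul_inv_rev, swap_inv]
      exact mul i j _ hij h hw) w⁻¹
  simpa using this

lemma len_mul_le (y w : Perm (Fin r)) : len (y * w) ≤ len y + len w := by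
  induction w using right_induction with
  | one => simp
  | mul i j w hij h ih =>
    rw [← mul_assoc, len_mul_swap hij h]
    rcases lt_or_gt_of_ne (show (y * w) i ≠ (y * w) j from fun hc =>
      hij.lt.ne ((y * w).injective hc)) with h' | h'
    · rw [len_mul_swap hij h']; omega
    · have := len_mul_swap' hij h'; omega

end Inversions

/-! ### Rows and shortest coset representatives -/

section Rows

variable {m n r : ℕ}

lemma hat_eq_zero_or_one (m n : ℕ) (i : Fin (m + n)) : hat m n i = 0 ∨ hat m n i = 1 := by
  unfold hat
  split_ifs <;> simp

lemma hat_ne_zero_iff {i : Fin (m + n)} : hat m n i ≠ 0 ↔ hat m n i = 1 := by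
  rcases hat_eq_zero_or_one m n i with h | h <;> simp [h]

lemma hat_eq_of_add_ne {i j : Fin (m + n)} (h : hat m n i + hat m n j ≠ 1) :
    hat m n i = hat m n j := by
  rcases hat_eq_zero_or_one m n i with h1 | h1 <;> rcases hat_eq_zero_or_one m n j with h2 | h2 <;>
    simp_all

/-- The index of the row of `ν` that contains `k`. -/
noncomputable def Weight.idx (ν : Weight m n r) (k : Fin r) : Fin (m + n) :=
  (ν.exists_row k).choose

variable {ν ρ : Weight m n r}

lemma Weight.mem_row {k : Fin r} {i : Fin (m + n)} : k ∈ ν.row i ↔ ν.idx k = i :=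
  ⟨fun h => ν.row_unique (ν.exists_row k).choose_spec h,
    fun h => h ▸ (ν.exists_row k).choose_spec⟩

lemma Weight.idx_mono (ν : Weight m n r) : Monotone ν.idx := by
  intro a b hab
  by_contra! hlt
  have ha := Weight.mem_row.2 (rfl : ν.idx a = _)
  have hb := Weight.mem_row.2 (rfl : ν.idx b = _)
  simp only [Weight.row, Finset.mem_filter, Finset.mem_univ, true_and] at ha hb
  have : ∑ l ∈ Finset.Iic (ν.idx b), ν.1 l ≤ ∑ l ∈ Finset.Iio (ν.idx a), ν.1 l :=
    Finset.sum_le_sum_of_subset fun x hx => by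
      simp only [Finset.mem_Iic, Finset.mem_Iio] at hx ⊢
      exact lt_of_le_of_lt hx hlt
  have := Fin.le_def.1 hab
  omega

lemma Weight.idx_eq_of_le {a b c : Fin r} (hab : a ≤ b) (hbc : b ≤ c) (h : ν.idx a = ν.idx c) :
    ν.idx b = ν.idx a :=
  le_antisymm ((ν.idx_mono hbc).trans h.ge) (ν.idx_mono hab)

lemma Weight.lt_of_idx_lt {a b : Fin r} (h : ν.idx a < ν.idx b) : a < b :=
  lt_of_not_ge fun hba => (ν.idx_mono hba).not_gt h

lemma mem_young {w : Perm (Fin r)} : w ∈ young ν ↔ ∀ k, ν.idx (w k) = ν.idx k := by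
  change (∀ i k, w k ∈ ν.row i ↔ k ∈ ν.row i) ↔ _
  simp only [Weight.mem_row]
  exact ⟨fun h k => (h _ k).2 rfl, fun h i k => by rw [h]⟩

lemma mem_youngPart {e : ZMod 2} {w : Perm (Fin r)} :
    w ∈ youngPart e ν ↔ w ∈ young ν ∧ ∀ k, hat m n (ν.idx k) ≠ e → w k = k := by
  change (w ∈ young ν ∧ ∀ i, hat m n i ≠ e → ∀ k ∈ ν.row i, w k = k) ↔ _
  simp only [Weight.mem_row]
  exact and_congr_right fun _ => ⟨fun h k hk => h _ hk k rfl, fun h i hi k hk => h k (hk ▸ hi)⟩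

lemma swap_mem_young {i j : Fin r} (h : ν.idx i = ν.idx j) : swap i j ∈ young ν :=
  mem_young.2 fun k => by
    rw [swap_apply_def]
    split_ifs with h1 h2
    · rw [h1, h]
    · rw [h2, h]
    · rfl

lemma swap_mem_youngPart {i j : Fin r} (h : ν.idx i = ν.idx j) :
    swap i j ∈ youngPart (hat m n (ν.idx i)) ν :=
  mem_youngPart.2 ⟨swap_mem_young h, fun k hk => swap_apply_of_ne_of_ne
    (fun hc => hk (by rw [hc])) (fun hc => hk (by rw [hc, h]))⟩

/-- The permutation `f` increases on each row of `ν`. -/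
def RowInc (ν : Weight m n r) (f : Perm (Fin r)) : Prop :=
  ∀ a b, a < b → ν.idx a = ν.idx b → f a < f b

/-- Rows are intervals, so all consecutive pairs between two points of a row stay in that row and
the inequalities chain. -/
lemma rowInc_of_adj {f : Perm (Fin r)}
    (h : ∀ i j, Adj i j → ν.idx i = ν.idx j → f i < f j) : RowInc ν f := fun _ _ hab hrow =>
  lt_of_adj f hab fun i j hij hi hj => h i j hij
    ((ν.idx_eq_of_le hi (hij.lt.le.trans hj) hrow).trans
      (ν.idx_eq_of_le (hi.trans hij.lt.le) hj hrow).symm)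

lemma young_lt {w : Perm (Fin r)} (hw : w ∈ young ν) {p q : Fin r} (h : p < q)
    (hne : ν.idx p ≠ ν.idx q) : w p < w q := by
  refine Weight.lt_of_idx_lt (ν := ν) ?_
  rw [mem_young.1 hw, mem_young.1 hw]
  exact lt_of_le_of_ne (ν.idx_mono h.le) hne

/-- An inversion of an element of the Young subgroup is a pair in one row. -/
lemma young_idx_eq {w : Perm (Fin r)} (hw : w ∈ young ν) {p q : Fin r} (h : p < q)
    (hlt : w q < w p) : ν.idx p = ν.idx q := by
  by_contra hne
  exact hlt.asymm (young_lt hw h hne)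

/-- Split the inversions `p, q` of `w * d` by whether `d p` and `d q` share a row. If they do, `d`
keeps the order of the pair and the inversion comes from `w`. If not, `w` keeps the order of the
images and the inversion comes from `d`, which has no inversion of the other kind. -/
lemma len_young_mul {w d : Perm (Fin r)} (hw : w ∈ young ν) (hd : RowInc ν d⁻¹) :
    len (w * d) = len w + len d := by
  rw [← cnt_true (w * d), ← cnt_add _ (fun p q => ν.idx (d p) = ν.idx (d q))]
  congr 1
  · rw [cnt_comp (Q' := fun p q => ν.idx p = ν.idx q), ← cnt_true]
    · exact cnt_congr fun p q hpq => ⟨fun h => ⟨h.1, trivial⟩, fun h => ⟨h.1, young_idx_eq hw hpq h.1⟩⟩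
    · simp
    · rintro p q hne ⟨-, h⟩
      refine ⟨fun hpq => lt_of_le_of_ne (le_of_not_gt fun hc => ?_) (d.injective.ne hne),
        fun hpq => by simpa using hd _ _ hpq h⟩
      exact hpq.asymm (by simpa using hd _ _ hc h.symm)
  · rw [← cnt_true]
    refine cnt_congr fun p q hpq => ⟨fun h => ⟨?_, trivial⟩, fun h => ⟨?_, trivial, fun hc => ?_⟩⟩
    · refine lt_of_le_of_ne (le_of_not_gt fun hc => ?_) (d.injective.ne hpq.ne')
      exact h.1.asymm (young_lt hw hc h.2.2)
    · refine young_lt hw h.1 fun hc => ?_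
      exact hpq.asymm (by simpa using hd _ _ h.1 hc)
    · exact hpq.asymm (by simpa using hd _ _ h.1 hc.symm)

lemma len_mul_young {x d : Perm (Fin r)} (hx : x ∈ young ν) (hd : RowInc ν d) :
    len (d * x) = len d + len x := by
  rw [← len_inv, mul_inv_rev, len_young_mul (inv_mem hx) (by rwa [inv_inv]), len_inv, len_inv,
    add_comm]

lemma lt_of_mem_minReps {W : Subgroup (Perm (Fin r))} {d : Perm (Fin r)} (hd : d ∈ minReps W)
    {i j : Fin r} (hij : Adj i j) (h : swap i j ∈ W) : d⁻¹ i < d⁻¹ j := by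
  by_contra hc
  have h1 := len_swap_mul' hij (lt_of_le_of_ne (not_lt.1 hc) (d⁻¹.injective.ne hij.lt.ne'))
  have h2 := hd _ h
  omega

/-- Minimality against adjacent transpositions within rows already forces monotonicity; conversely,
additivity of lengths gives minimality. -/
lemma mem_minReps_young {d : Perm (Fin r)} : d ∈ minReps (young ν) ↔ RowInc ν d⁻¹ :=
  ⟨fun hd => rowInc_of_adj fun _ _ hij hrow => lt_of_mem_minReps hd hij (swap_mem_young hrow),
    fun hd w hw => by rw [len_young_mul hw hd]; omega⟩

/-- Lengths add both in `d' = w d` and in `d = w⁻¹ d'`, which leaves no room for a nonzero length of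
`w`. -/
lemma eq_of_rowInc {w d d' : Perm (Fin r)} (hw : w ∈ young ν) (hd : RowInc ν d⁻¹)
    (hd' : RowInc ν d'⁻¹) (h : w * d = d') : w = 1 := by
  have h1 := len_young_mul hw hd
  have h2 := len_young_mul (inv_mem hw) hd'
  rw [h] at h1
  rw [← h, inv_mul_cancel_left, h] at h2
  exact eq_one_of_len (by omega)

/-! ### Double cosets -/

lemma jmat_apply (ν : Weight m n r) (w : Perm (Fin r)) (ρ : Weight m n r) (i j : Fin (m + n)) :
    jmat ν w ρ i j = (Finset.univ.filter fun p => ρ.idx p = j ∧ ν.idx (w p) = i).card := by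
  rw [jmat]
  conv_rhs => rw [← Finset.card_map w.toEmbedding]
  congr 1
  ext k
  simp only [Finset.mem_inter, Finset.mem_image, Finset.mem_map, Weight.mem_row, Finset.mem_filter,
    Finset.mem_univ, true_and, Equiv.coe_toEmbedding]
  constructor
  · rintro ⟨h, a, ha, rfl⟩
    exact ⟨a, ⟨ha, h⟩, rfl⟩
  · rintro ⟨a, ⟨ha, h⟩, rfl⟩
    exact ⟨h, a, ha, rfl⟩

lemma jmat_inv (ν : Weight m n r) (w : Perm (Fin r)) (ρ : Weight m n r) :
    jmat ρ w⁻¹ ν = (jmat ν w ρ).transpose := by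
  ext i j
  rw [Matrix.transpose_apply, jmat_apply, jmat_apply]
  conv_rhs => rw [← Finset.card_map w.toEmbedding]
  congr 1
  ext k
  simp only [Finset.mem_map, Finset.mem_filter, Finset.mem_univ, true_and, Equiv.coe_toEmbedding]
  constructor
  · rintro h
    exact ⟨w⁻¹ k, by simpa [and_comm] using h, by simp⟩
  · rintro ⟨a, h, rfl⟩
    simpa [and_comm] using h

lemma two_le_jmat {w : Perm (Fin r)} {p q : Fin r} (hpq : p ≠ q) (h : ρ.idx p = ρ.idx q)
    (h' : ν.idx (w p) = ν.idx (w q)) : 2 ≤ jmat ν w ρ (ν.idx (w p)) (ρ.idx p) := by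
  rw [jmat_apply]
  refine Finset.one_lt_card.2 ⟨p, by simp, q, ?_, hpq⟩
  simp [h, h']

/-- Two points in one block give an entry at least `2`, which a matrix in `M(m|n,r)` allows only
where row and column have equal parity. -/
lemma SMat.hat_eq {A : SMat m n r} {w : Perm (Fin r)} (hA : jmat ν w ρ = A.1) {p q : Fin r}
    (hpq : p ≠ q) (h : ρ.idx p = ρ.idx q) (h' : ν.idx (w p) = ν.idx (w q)) :
    hat m n (ν.idx (w p)) = hat m n (ρ.idx p) := by
  refine hat_eq_of_add_ne fun hc => ?_
  have h2 := two_le_jmat hpq h h'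
  have := A.2.1 _ _ hc
  rw [hA] at h2
  omega

/-- A shortest double coset representative is determined by its matrix. -/
lemma eq_of_jmat_eq {w w' : Perm (Fin r)} (h1 : RowInc ρ w) (h2 : RowInc ν w⁻¹)
    (h1' : RowInc ρ w') (h2' : RowInc ν w'⁻¹) (h : jmat ν w ρ = jmat ν w' ρ) : w = w' := by
  classical
  -- Label `p` by its row and by the row of its image. Monotonicity on rows makes the labelling
  -- increasing lexicographically, and the matrix records the multiplicity of each label, so `w` and
  -- `w'` have the same sorted list of labels. They then differ by an element of the Young subgroup
  -- on the left.
  let F : Perm (Fin r) → Fin r → Lex (Fin (m + n) × Fin (m + n)) :=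
    fun w p => toLex (ρ.idx p, ν.idx (w p))
  have hF : ∀ w, RowInc ρ w → Monotone (F w) := by
    intro w hw
    refine fun a b hab => Prod.Lex.toLex_le_toLex.2 ?_
    rcases hab.eq_or_lt with rfl | hab
    · exact Or.inr ⟨rfl, le_rfl⟩
    · rcases (ρ.idx_mono hab.le).eq_or_lt with he | hl
      · exact Or.inr ⟨he, ν.idx_mono (hw _ _ hab he).le⟩
      · exact Or.inl hl
  have hc : ∀ c, Nonempty ({p // F w p = c} ≃ {p // F w' p = c}) := fun c => by
    rw [← Fintype.card_eq, Fintype.card_subtype, Fintype.card_subtype]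
    have := congrFun (congrFun h (ofLex c).2) (ofLex c).1
    rw [jmat_apply, jmat_apply] at this
    convert this using 3 <;>
    · exact toLex_inj.trans Prod.ext_iff
  have hx := Equiv.ofFiberEquiv_map fun c => (hc c).some
  set x := Equiv.ofFiberEquiv fun c => (hc c).some
  have hFx : F w' ∘ x = F w := funext hx
  have hFF : F w' = F w := by
    have := Tuple.unique_monotone (f := F w') (σ := 1) (τ := x) (hF w' h1') (hFx ▸ hF w h1)
    rw [hFx] at this
    exact this
  have hy : w' * w⁻¹ ∈ young ν := mem_young.2 fun k => by
    have := congrArg (fun c => (ofLex c).2) (congrFun hFF (w⁻¹ k))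
    simpa [F] using this
  exact (mul_inv_eq_one.1 (eq_of_rowInc hy h2 h2' (by simp))).symm

lemma SMat.rep_mem (A : SMat m n r) : A.rep ∈ minDoubleReps A.ro A.co := A.exists_rep.choose_spec.1

lemma SMat.jmat_rep (A : SMat m n r) : jmat A.ro A.rep A.co = A.1 := A.exists_rep.choose_spec.2

lemma SMat.rowInc_rep_inv (A : SMat m n r) : RowInc A.ro A.rep⁻¹ := mem_minReps_young.1 A.rep_mem.1

lemma SMat.rowInc_rep (A : SMat m n r) : RowInc A.co A.rep := by
  simpa using mem_minReps_young.1 A.rep_mem.2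

lemma SMat.eq_rep {A : SMat m n r} {w : Perm (Fin r)} (h1 : RowInc A.co w) (h2 : RowInc A.ro w⁻¹)
    (h : jmat A.ro w A.co = A.1) : w = A.rep :=
  eq_of_jmat_eq h1 h2 A.rowInc_rep A.rowInc_rep_inv (h.trans A.jmat_rep.symm)

/-- The double coset representative maps consecutive points to consecutive points, within a block
of its matrix. -/
lemma adj_of_adj {w : Perm (Fin r)} (h1 : RowInc ρ w) (h2 : RowInc ν w⁻¹) {p q : Fin r}
    (hpq : Adj p q) (h : ρ.idx p = ρ.idx q) (h' : ν.idx (w p) = ν.idx (w q)) :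
    Adj (w p) (w q) := by
  have hlt := h1 _ _ hpq.lt h
  by_contra hc
  have hb : (w p : ℕ) + 1 < w q := by
    have := Fin.lt_def.1 hlt
    unfold Adj at hc
    omega
  -- A point strictly between the images would lie in the same row of `ν`, and its preimage would
  -- lie strictly between the consecutive points `p` and `q`.
  let k : Fin r := ⟨(w p : ℕ) + 1, hb.trans (w q).2⟩
  have hpk : w p < k := Fin.lt_def.2 (Nat.lt_succ_self _)
  have hkq : k < w q := Fin.lt_def.2 hb
  have hk := ν.idx_eq_of_le hpk.le hkq.le h'
  have e1 := h2 _ _ hpk hk.symm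
  have e2 := h2 _ _ hkq (hk.trans h')
  simp only [Perm.coe_inv, symm_apply_apply, Fin.lt_def] at e1 e2
  unfold Adj at hpq
  omega

/-- The part of a row of `ρ` that `w` sends to a given row of `ν` is an interval, because `w`
increases on the row. So the successor of the smaller of two of its points is again in it. The
resulting pair of transpositions satisfies `s w = w t`. -/
lemma exists_adj_of_two_le {w : Perm (Fin r)} (h1 : RowInc ρ w) (h2 : RowInc ν w⁻¹)
    {i j : Fin (m + n)} (h : 2 ≤ jmat ν w ρ i j) :
    ∃ p q, Adj p q ∧ Adj (w p) (w q) ∧ ρ.idx p = j ∧ ρ.idx q = j ∧ ν.idx (w p) = i ∧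
      ν.idx (w q) = i := by
  rw [jmat_apply] at h
  obtain ⟨a, ha, b, hb, hab⟩ := Finset.one_lt_card.1 h
  simp only [Finset.mem_filter, Finset.mem_univ, true_and] at ha hb
  wlog hlt : a < b generalizing a b
  · exact this b a hab.symm hb ha (lt_of_le_of_ne (not_lt.1 hlt) hab.symm)
  let q : Fin r := ⟨(a : ℕ) + 1, lt_of_le_of_lt (Fin.lt_def.1 hlt) b.2⟩
  have haq : Adj a q := rfl
  have hqb : q ≤ b := Fin.lt_def.1 hlt
  have hq := ρ.idx_eq_of_le haq.lt.le hqb (ha.1.trans hb.1.symm)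
  have hwq := ν.idx_eq_of_le (h1 _ _ haq.lt hq.symm).le (b := w q) (c := w b) (by
    rcases hqb.eq_or_lt with he | hl
    · rw [he]
    · exact (h1 _ _ hl (hq.trans (ha.1.trans hb.1.symm))).le) (ha.2.trans hb.2.symm)
  exact ⟨a, q, haq, adj_of_adj h1 h2 haq hq.symm hwq.symm, ha.1, hq.trans ha.1, ha.2,
    hwq.trans ha.2⟩

/-- Remove descents within rows of `ρ` from the right. Each removal shortens the element; it keeps
the order of preimages along rows of `ν`, because a pair reversed by it would have been a descent in
the wrong direction. -/
lemma exists_young_rowInc (ρ : Weight m n r) (e : Perm (Fin r)) (he : RowInc ν e⁻¹) :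
    ∃ x ∈ young ρ, RowInc ρ (e * x) ∧ RowInc ν (e * x)⁻¹ := by
  induction hl : len e using Nat.strong_induction_on generalizing e with
  | _ l ih =>
    by_cases hr : RowInc ρ e
    · exact ⟨1, one_mem _, by simpa using hr, by simpa using he⟩
    · obtain ⟨i, j, hij, hrow, hlt⟩ : ∃ i j, Adj i j ∧ ρ.idx i = ρ.idx j ∧ e j < e i := by
        by_contra! hc
        exact hr (rowInc_of_adj fun i j hij hrow =>
          lt_of_le_of_ne (hc i j hij hrow) (e.injective.ne hij.lt.ne))
      obtain ⟨x, hx, h1, h2⟩ := ih (len (e * swap i j))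
        (by have := len_mul_swap' hij hlt; omega) (e * swap i j) (fun a b hab hab' => by
          rw [mul_inv_rev, swap_inv]
          refine hij.swap_lt_swap (he a b hab hab') ?_
          rintro ⟨rfl, rfl⟩
          exact hab.asymm (by simpa using hlt)) rfl
      exact ⟨swap i j * x, mul_mem (swap_mem_young hrow) hx, by rwa [← mul_assoc],
        by rwa [← mul_assoc]⟩

/-! ### The parts of a Young subgroup -/

lemma young_mul_apply {u v : Perm (Fin r)} (hu : u ∈ youngPart 0 ν) (hv : v ∈ youngPart 1 ν)
    (k : Fin r) : (u * v) k = if hat m n (ν.idx k) = 1 then v k else u k := by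
  rw [mem_youngPart] at hu hv
  split_ifs with h
  · exact hu.2 _ (by rw [mem_young.1 hv.1, h]; decide)
  · rw [Perm.mul_apply, hv.2 _ h]

lemma youngPart_eq {u v u' v' : Perm (Fin r)} (hu : u ∈ youngPart 0 ν) (hv : v ∈ youngPart 1 ν)
    (hu' : u' ∈ youngPart 0 ν) (hv' : v' ∈ youngPart 1 ν) (h : u * v = u' * v') :
    u = u' ∧ v = v' := by
  have key : v = v' := Equiv.ext fun k => by
    have := congrArg (fun w => w k) h
    simp only [young_mul_apply hu hv, young_mul_apply hu' hv'] at this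
    by_cases hk : hat m n (ν.idx k) = 1
    · simpa [hk] using this
    · rw [(mem_youngPart.1 hv).2 _ hk, (mem_youngPart.1 hv').2 _ hk]
  subst key
  exact ⟨mul_right_cancel h, rfl⟩

lemma exists_youngPart {w : Perm (Fin r)} (hw : w ∈ young ν) :
    ∃ u ∈ youngPart 0 ν, ∃ v ∈ youngPart 1 ν, u * v = w := by
  classical
  have hp : ∀ k, hat m n (ν.idx (w k)) = 1 ↔ hat m n (ν.idx k) = 1 := fun k => by
    rw [mem_young.1 hw]
  -- The odd factor is the restriction of `w` to the union of the odd rows, which `w` preserves.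
  let v := Perm.ofSubtype (w.subtypePerm (p := fun k => hat m n (ν.idx k) = 1) hp)
  have hv1 : ∀ k, hat m n (ν.idx k) = 1 → v k = w k := fun k hk =>
    Perm.ofSubtype_apply_of_mem (w.subtypePerm (p := fun k => hat m n (ν.idx k) = 1) hp) hk
  have hv0 : ∀ k, hat m n (ν.idx k) ≠ 1 → v k = k := fun k hk =>
    Perm.ofSubtype_apply_of_not_mem _ hk
  have hv : v ∈ youngPart 1 ν := mem_youngPart.2 ⟨mem_young.2 fun k => by
    by_cases hk : hat m n (ν.idx k) = 1
    · rw [hv1 k hk, mem_young.1 hw]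
    · rw [hv0 k hk], hv0⟩
  refine ⟨w * v⁻¹, mem_youngPart.2 ⟨mul_mem hw (inv_mem (mem_youngPart.1 hv).1), fun k hk => ?_⟩,
    v, hv, by simp⟩
  rw [hat_ne_zero_iff] at hk
  have h2 : hat m n (ν.idx (v⁻¹ k)) = 1 := by rw [mem_young.1 (inv_mem (mem_youngPart.1 hv).1), hk]
  rw [Perm.mul_apply, ← hv1 _ h2]
  simp

/-- On odd rows `u * v` acts as `v`, and `v` has no inversions elsewhere. -/
lemma cnt_odd {u v : Perm (Fin r)} (hu : u ∈ youngPart 0 ν) (hv : v ∈ youngPart 1 ν) :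
    cnt (fun p q => ν.idx p = ν.idx q ∧ hat m n (ν.idx p) = 1) (u * v) = len v := by
  rw [← cnt_true]
  refine cnt_congr fun p q hpq => ?_
  have hv' := (mem_youngPart.1 hv)
  simp only [young_mul_apply hu hv]
  constructor
  · rintro ⟨h, h1, h2⟩
    rw [← h1, if_pos h2, if_pos h2] at h
    exact ⟨h, trivial⟩
  · rintro ⟨h, -⟩
    have h1 := young_idx_eq hv'.1 hpq h
    have h2 : hat m n (ν.idx p) = 1 := by
      by_contra h2
      rw [hv'.2 _ h2, hv'.2 _ (h1 ▸ h2)] at h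
      exact h.asymm hpq
    rw [← h1, if_pos h2, if_pos h2]
    exact ⟨h, rfl, h2⟩

lemma len_youngPart_mul {u v : Perm (Fin r)} (hu : u ∈ youngPart 0 ν) (hv : v ∈ youngPart 1 ν) :
    len (u * v) = len u + len v := by
  have hu' := mem_youngPart.1 hu
  have hv' := mem_youngPart.1 hv
  rw [← cnt_true (u * v), ← cnt_add _ (fun p q => ν.idx p = ν.idx q ∧ hat m n (ν.idx p) = 1),
    add_comm]
  congr 1
  · rw [← cnt_true]
    refine cnt_congr fun p q hpq => ?_
    simp only [young_mul_apply hu hv]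
    constructor
    · rintro ⟨h, -, h2⟩
      have h1 : ν.idx p = ν.idx q := young_idx_eq (mul_mem hu'.1 hv'.1) hpq
        (by simpa only [young_mul_apply hu hv] using h)
      have h3 : ¬hat m n (ν.idx p) = 1 := fun h3 => h2 ⟨h1, h3⟩
      rw [← h1, if_neg h3, if_neg h3] at h
      exact ⟨h, trivial⟩
    · rintro ⟨h, -⟩
      have h1 := young_idx_eq hu'.1 hpq h
      have h2 : ¬hat m n (ν.idx p) = 1 := by
        intro h2
        rw [hu'.2 q (by rw [← h1, h2]; decide), hu'.2 p (by rw [h2]; decide)] at h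
        exact h.asymm hpq
      rw [← h1, if_neg h2, if_neg h2]
      exact ⟨h, trivial, fun hc => h2 hc.2⟩
  · rw [← cnt_odd hu hv]
    exact cnt_congr fun p q _ => by simp

/-! ### The number of odd inversions -/

/-- The number of inversions of `w` that lie in an odd row of `ρ`, or whose image under `w` lies in
an odd row of `ν`. -/
noncomputable def stat (ν ρ : Weight m n r) (w : Perm (Fin r)) : ℕ :=
  cnt (fun p q => (ρ.idx p = ρ.idx q ∧ hat m n (ρ.idx p) = 1) ∨
    (ν.idx (w p) = ν.idx (w q) ∧ hat m n (ν.idx (w p)) = 1)) w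

/-- Inversion exchanges the two alternatives in `stat`. This symmetry lets one exponent serve for
the left and for the right sign behaviour. -/
lemma stat_inv (ν ρ : Weight m n r) (w : Perm (Fin r)) : stat ρ ν w⁻¹ = stat ν ρ w := by
  rw [stat, cnt_inv, stat]
  refine cnt_congr fun p q _ => and_congr_right fun _ => ?_
  simp only [Perm.coe_inv, symm_apply_apply]
  rw [or_comm]
  refine or_congr ⟨?_, ?_⟩ ⟨?_, ?_⟩ <;>
  · rintro ⟨h1, h2⟩
    exact ⟨h1.symm, by rw [← h2, h1]⟩

-- Only the new inversion `(i, j)` matters. If it is counted because its images share an odd row of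
-- `ν`, the two points lie in one block, so `SMat.hat_eq` makes the row of `ρ` odd too. Here the
-- restriction on the odd entries of `A` is essential.
open Classical in
lemma stat_mul_swap {w : Perm (Fin r)} {A : SMat m n r} (hA : jmat ν w ρ = A.1) {i j : Fin r}
    (hij : Adj i j) (hrow : ρ.idx i = ρ.idx j) (h : w i < w j) :
    stat ν ρ (w * swap i j) = stat ν ρ w + if hat m n (ρ.idx i) = 1 then 1 else 0 := by
  rw [stat, cnt_mul_swap (Q := fun p q => (ρ.idx p = ρ.idx q ∧ hat m n (ρ.idx p) = 1) ∨
    (ν.idx (w p) = ν.idx (w q) ∧ hat m n (ν.idx (w p)) = 1)) hij h, ← stat]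
  · congr 2
    rw [eq_iff_iff, hrow]
    refine ⟨?_, fun h => Or.inl ⟨rfl, h⟩⟩
    rintro (h | h)
    · exact h.2
    · exact (SMat.hat_eq hA hij.lt.ne' hrow.symm h.1).symm.trans h.2
  · intro p q
    simp only [mem_young.1 (swap_mem_young hrow), Perm.mul_apply]

lemma stat_eq_zero {w : Perm (Fin r)} (h1 : RowInc ρ w) (h2 : RowInc ν w⁻¹) : stat ν ρ w = 0 := by
  refine cnt_eq_zero fun p q hpq h => ?_
  rcases h with h | h
  · exact h1 _ _ hpq h.1
  · refine lt_of_le_of_ne (le_of_not_gt fun hc => ?_) (w.injective.ne hpq.ne)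
    exact hpq.asymm (by simpa using h2 _ _ hc h.1.symm)

lemma stat_young {u v : Perm (Fin r)} (hu : u ∈ youngPart 0 ν) (hv : v ∈ youngPart 1 ν) :
    stat ν ν (u * v) = len v := by
  rw [← cnt_odd hu hv]
  have h := mul_mem (mem_youngPart.1 hu).1 (mem_youngPart.1 hv).1
  refine cnt_congr fun p q _ => and_congr_right fun _ => ?_
  rw [mem_young.1 h, mem_young.1 h, or_self]

/-- Since the product is shortest in its `S_ν`-coset, no inversion has both images in one row of
`ν`; since `d` increases on rows of `ρ`, the inversions in odd rows of `ρ` are those of `v`. This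
accounts for the factor `(-q)^(-l(v))` in the definition of `T_A`. -/
lemma stat_mul_young {d u v : Perm (Fin r)} (hd : RowInc ρ d) (hu : u ∈ youngPart 0 ρ)
    (hv : v ∈ youngPart 1 ρ) (hm : RowInc ν (d * (u * v))⁻¹) :
    stat ν ρ (d * (u * v)) = len v := by
  rw [← cnt_odd hu hv]
  have h := mul_mem (mem_youngPart.1 hu).1 (mem_youngPart.1 hv).1
  set x := u * v
  have key : ∀ p q, p < q → ρ.idx p = ρ.idx q → ((d * x) q < (d * x) p ↔ x q < x p) := by
    intro p q hpq hrow
    have hx : ρ.idx (x p) = ρ.idx (x q) := by rw [mem_young.1 h, mem_young.1 h, hrow]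
    refine ⟨fun hlt => lt_of_le_of_ne (le_of_not_gt fun hc => ?_) (x.injective.ne hpq.ne'),
      fun hlt => hd _ _ hlt hx.symm⟩
    exact hlt.asymm (hd _ _ hc hx)
  refine cnt_congr fun p q hpq => ⟨?_, ?_⟩
  · rintro ⟨h1, h2 | h2⟩
    · exact ⟨(key p q hpq h2.1).1 h1, h2⟩
    · exact absurd (hm _ _ h1 h2.1.symm) (by simpa using hpq.le)
  · rintro ⟨h1, h2⟩
    exact ⟨(key p q hpq h2.1).2 h1, Or.inl h2⟩

/-! ### The elements of a double coset that are shortest in their left coset -/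

lemma SMat.conj_mem {e : ZMod 2} {A : SMat m n r} {g : Perm (Fin r)} :
    g ∈ A.interPart e ↔ A.rep * g * A.rep⁻¹ ∈ youngPart e A.ro ∧ g ∈ youngPart e A.co := by
  rw [SMat.interPart, Subgroup.mem_inf]
  refine and_congr_left fun _ => ⟨?_, fun h => ?_⟩
  · rintro ⟨a, ha, rfl⟩
    simpa [mul_assoc] using ha
  · exact ⟨_, h, by simp [mul_assoc]⟩

/-- Take adjacent points in a row of `A.ro`. If their preimages under `d` lie in different column
rows, `x⁻¹` keeps their order. Otherwise the preimages are adjacent, and their transposition lies in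
`A.interPart e` for the common parity `e`. Conversely, for `g` in the subgroup, computing the length
of `d g x = (d g d⁻¹) d x` in two ways gives `len x ≤ len (g * x)`. -/
lemma SMat.mem_minReps_inter {A : SMat m n r} {x : Perm (Fin r)} (hx : x ∈ young A.co) :
    x ∈ minReps (A.interPart 0 ⊔ A.interPart 1) ↔ RowInc A.ro (A.rep * x)⁻¹ := by
  constructor
  · intro h
    refine rowInc_of_adj fun a b hab hrow => ?_
    rw [mul_inv_rev, Perm.mul_apply, Perm.mul_apply]
    have hlt := A.rowInc_rep_inv _ _ hab.lt hrow
    by_cases hne : A.co.idx (A.rep⁻¹ a) = A.co.idx (A.rep⁻¹ b)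
    · have hadj : Adj (A.rep⁻¹ a) (A.rep⁻¹ b) :=
        adj_of_adj A.rowInc_rep_inv (by simpa using A.rowInc_rep) hab hrow hne
      refine lt_of_mem_minReps h hadj ?_
      have hpar := SMat.hat_eq A.jmat_rep hlt.ne hne (by simpa using hrow)
      have hmem : swap (A.rep⁻¹ a) (A.rep⁻¹ b) ∈ A.interPart (hat m n (A.ro.idx a)) := by
        rw [SMat.conj_mem]
        constructor
        · have : A.rep * swap (A.rep⁻¹ a) (A.rep⁻¹ b) * A.rep⁻¹ = swap a b := by
            rw [mul_swap_eq_swap_mul]; simp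
          rw [this]
          exact swap_mem_youngPart hrow
        · have := swap_mem_youngPart hne
          rw [← hpar] at this
          simpa using this
      rcases hat_eq_zero_or_one m n (A.ro.idx a) with h0 | h0 <;> rw [h0] at hmem
      · exact (le_sup_left : A.interPart 0 ≤ _) hmem
      · exact (le_sup_right : A.interPart 1 ≤ _) hmem
    · exact young_lt (inv_mem hx) hlt hne
  · intro h g hg
    have hle : A.interPart 0 ⊔ A.interPart 1 ≤
        (young A.ro).comap (MulAut.conj A.rep).toMonoidHom ⊓ young A.co := by
      refine sup_le ?_ ?_ <;>
      · intro g hg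
        rw [SMat.conj_mem, mem_youngPart, mem_youngPart] at hg
        exact ⟨hg.1.1, hg.2.1⟩
    obtain ⟨h1, h2⟩ := hle hg
    have e1 := len_young_mul (w := A.rep * g * A.rep⁻¹) (by simpa using h1) h
    have e2 := len_mul_young hx A.rowInc_rep
    have e3 := len_mul_young (mul_mem h2 hx) A.rowInc_rep
    rw [show A.rep * g * A.rep⁻¹ * (A.rep * x) = A.rep * (g * x) by group] at e1
    omega

/-- Sorting `e` on the column rows ends at a shortest representative, which its matrix identifies as
`A.rep`. -/
lemma SMat.exists_eq_rep_mul {A : SMat m n r} {e : Perm (Fin r)} (hA : jmat A.ro e A.co = A.1)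
    (he : RowInc A.ro e⁻¹) : ∃ x ∈ young A.co, A.rep * x = e := by
  obtain ⟨x, hx, h1, h2⟩ := exists_young_rowInc A.co e he
  refine ⟨x⁻¹, inv_mem hx, ?_⟩
  rw [← A.eq_rep h1 h2 (by rw [jmat_mul_right _ _ hx, hA])]
  simp

end Rows

/-! ### The basis of the Hecke algebra -/

section HeckeBasis

variable {r : ℕ} (R : Type*) [CommRing R] [Algebra ℤ[T;T⁻¹] R]

open Classical in
/-- Left multiplication by `T_s`, `s = (i j)`, in terms of coefficients. -/
noncomputable def leftOp (i j : Fin r) : (Perm (Fin r) → R) →ₗ[R] (Perm (Fin r) → R) where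
  toFun c w := if w⁻¹ i < w⁻¹ j then (qUnit R : R) * c (swap i j * w)
    else c (swap i j * w) + ((qUnit R : R) - 1) * c w
  map_add' c c' := by ext w; dsimp only [Pi.add_apply]; split_ifs <;> ring
  map_smul' a c := by
    ext w; dsimp only [Pi.smul_apply, smul_eq_mul, RingHom.id_apply]; split_ifs <;> ring

open Classical in
/-- Right multiplication by `T_s`, `s = (i j)`, in terms of coefficients. -/
noncomputable def rightOp (i j : Fin r) : (Perm (Fin r) → R) →ₗ[R] (Perm (Fin r) → R) where
  toFun c w := if w i < w j then (qUnit R : R) * c (w * swap i j)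
    else c (w * swap i j) + ((qUnit R : R) - 1) * c w
  map_add' c c' := by ext w; dsimp only [Pi.add_apply]; split_ifs <;> ring
  map_smul' a c := by
    ext w; dsimp only [Pi.smul_apply, smul_eq_mul, RingHom.id_apply]; split_ifs <;> ring

variable {R}

open Classical in
lemma leftOp_apply (i j : Fin r) (c : Perm (Fin r) → R) (w : Perm (Fin r)) :
    leftOp R i j c w = if w⁻¹ i < w⁻¹ j then (qUnit R : R) * c (swap i j * w)
      else c (swap i j * w) + ((qUnit R : R) - 1) * c w := by
  simp only [leftOp, LinearMap.coe_mk, AddHom.coe_mk]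

open Classical in
lemma rightOp_apply (i j : Fin r) (c : Perm (Fin r) → R) (w : Perm (Fin r)) :
    rightOp R i j c w = if w i < w j then (qUnit R : R) * c (w * swap i j)
      else c (w * swap i j) + ((qUnit R : R) - 1) * c w := by
  simp only [rightOp, LinearMap.coe_mk, AddHom.coe_mk]

/-- If `s w = w t`, the order tests on both sides agree and the two operators act alike at `w`.
Otherwise neither multiplication affects the test made by the other. -/
lemma leftOp_comm_rightOp {i j a b : Fin r} (hij : Adj i j) (hab : Adj a b) :
    Commute (leftOp R i j) (rightOp R a b) := by
  refine LinearMap.ext fun c => funext fun w => ?_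
  simp only [Module.End.mul_apply, leftOp_apply, rightOp_apply, Perm.mul_apply, mul_inv_rev,
    swap_inv, mul_assoc]
  by_cases h : swap i j * w = w * swap a b
  · have e1 : swap i j (w a) = w b := by simpa using congrArg (fun x => x a) h
    have e2 : swap i j (w b) = w a := by simpa using congrArg (fun x => x b) h
    have h' : w⁻¹ * swap i j = swap a b * w⁻¹ := by
      rw [inv_mul_eq_iff_eq_mul, ← mul_assoc, ← h]; simp [mul_assoc]
    have e3 : swap a b (w⁻¹ i) = w⁻¹ j := by simpa using congrArg (fun x => x i) h'.symm
    have e4 : swap a b (w⁻¹ j) = w⁻¹ i := by simpa using congrArg (fun x => x j) h'.symm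
    have h2 : swap i j * (w * swap a b) = w := by rw [← h, ← mul_assoc, swap_mul_self, one_mul]
    have hw : w a < w b ↔ w⁻¹ i < w⁻¹ j := by
      have : (w a = i ∧ w b = j) ∨ (w a = j ∧ w b = i) := by
        have hne : w a ≠ w b := w.injective.ne hab.lt.ne
        rw [swap_apply_def] at e1
        split_ifs at e1 with h1 h3
        · exact Or.inl ⟨h1, e1.symm⟩
        · exact Or.inr ⟨h3, e1.symm⟩
        · exact absurd e1 hne
      rcases this with ⟨rfl, rfl⟩ | ⟨rfl, rfl⟩
      · simpa using iff_of_true hij.lt hab.lt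
      · simpa using iff_of_false hij.lt.asymm hab.lt.asymm
    rw [e1, e2, e3, e4, h2, h]
    have hne : w a ≠ w b := w.injective.ne hab.lt.ne
    have hne' : w⁻¹ i ≠ w⁻¹ j := w⁻¹.injective.ne hij.lt.ne
    by_cases hlt : w a < w b
    · simp only [hlt, hw.1 hlt, hlt.asymm, (hw.1 hlt).asymm, if_true, if_false]
    · have h3 := lt_of_le_of_ne (not_lt.1 hlt) hne.symm
      have h4 := lt_of_le_of_ne (not_lt.1 (hw.not.1 hlt)) hne'.symm
      simp only [hlt, hw.not.1 hlt, h3, h4, if_true, if_false]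
  · have e1 : swap i j (w a) < swap i j (w b) ↔ w a < w b := by
      refine hij.swap_lt_swap_iff ?_ ?_
      · rintro ⟨rfl, rfl⟩
        exact h (mul_swap_eq_swap_mul w a b).symm
      · rintro ⟨rfl, rfl⟩
        rw [swap_comm] at h
        exact h (mul_swap_eq_swap_mul w a b).symm
    have e2 : swap a b (w⁻¹ i) < swap a b (w⁻¹ j) ↔ w⁻¹ i < w⁻¹ j := by
      refine hab.swap_lt_swap_iff ?_ ?_
      · rintro ⟨rfl, rfl⟩
        exact h (by rw [mul_swap_eq_swap_mul]; simp)
      · rintro ⟨rfl, rfl⟩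
        exact h (by rw [mul_swap_eq_swap_mul, swap_comm]; simp)
    simp only [e1, e2]
    split_ifs <;> ring

lemma leftOp_sq {i j : Fin r} (hij : Adj i j) :
    leftOp R i j * leftOp R i j = ((qUnit R : R) - 1) • leftOp R i j + (qUnit R : R) • 1 := by
  refine LinearMap.ext fun c => funext fun w => ?_
  have hne : w⁻¹ i ≠ w⁻¹ j := w⁻¹.injective.ne hij.lt.ne
  simp only [Module.End.mul_apply, leftOp_apply, LinearMap.add_apply, LinearMap.smul_apply,
    Pi.add_apply, Pi.smul_apply, smul_eq_mul, Module.End.one_apply, Perm.mul_apply, mul_inv_rev,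
    swap_inv, ← mul_assoc, swap_mul_self, one_mul, swap_apply_left, swap_apply_right]
  rcases lt_or_gt_of_ne hne with h | h
  · simp only [h, h.asymm, if_true, if_false]; ring
  · simp only [h, h.asymm, if_true, if_false]; ring

open Classical in
lemma leftOp_single {i j : Fin r} {w : Perm (Fin r)} (h : w⁻¹ i < w⁻¹ j) :
    leftOp R i j (Pi.single w 1) = Pi.single (swap i j * w) 1 := by
  ext x
  rw [leftOp_apply]
  by_cases hx : x = swap i j * w
  · subst hx
    have c1 : ¬(swap i j * w)⁻¹ i < (swap i j * w)⁻¹ j := by simpa using h.le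
    have c2 : swap i j * w ≠ w := fun hc => c1 (by rwa [hc])
    rw [if_neg c1, ← mul_assoc, swap_mul_self, one_mul, Pi.single_eq_same, Pi.single_eq_same,
      Pi.single_eq_of_ne c2, mul_zero, add_zero]
  · have : swap i j * x ≠ w := fun hc => hx (by rw [← hc, ← mul_assoc]; simp)
    rw [Pi.single_eq_of_ne this, Pi.single_eq_of_ne hx]
    by_cases hxw : x = w
    · rw [hxw, if_pos h, mul_zero]
    · rw [Pi.single_eq_of_ne hxw]
      simp

open Classical in
lemma rightOp_single {i j : Fin r} {w : Perm (Fin r)} (h : w i < w j) :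
    rightOp R i j (Pi.single w 1) = Pi.single (w * swap i j) 1 := by
  ext x
  rw [rightOp_apply]
  by_cases hx : x = w * swap i j
  · subst hx
    have c1 : ¬(w * swap i j) i < (w * swap i j) j := by simpa using h.le
    have c2 : w * swap i j ≠ w := fun hc => c1 (by rwa [hc])
    rw [if_neg c1, mul_assoc, swap_mul_self, mul_one, Pi.single_eq_same, Pi.single_eq_same,
      Pi.single_eq_of_ne c2, mul_zero, add_zero]
  · have : x * swap i j ≠ w := fun hc => hx (by rw [← hc, mul_assoc]; simp)
    rw [Pi.single_eq_of_ne this, Pi.single_eq_of_ne hx]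
    by_cases hxw : x = w
    · rw [hxw, if_pos h, mul_zero]
    · rw [Pi.single_eq_of_ne hxw]
      simp

variable (R) in
/-- The endomorphism commutes with all right multiplications. -/
def RightComm (f : Module.End R (Perm (Fin r) → R)) : Prop :=
  ∀ i j : Fin r, Adj i j → Commute f (rightOp R i j)

-- Right operators along a reduced word carry the unit vector at `1` to the one at any `w`, so the
-- value at `1` determines everything.
open Classical in
lemma RightComm.ext {f g : Module.End R (Perm (Fin r) → R)} (hf : RightComm R f)
    (hg : RightComm R g) (h : f (Pi.single 1 1) = g (Pi.single 1 1)) : f = g := by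
  have key : ∀ w : Perm (Fin r), f (Pi.single w 1) = g (Pi.single w 1) := by
    intro w
    induction w using right_induction with
    | one => exact h
    | mul i j w hij hw ih =>
      rw [← rightOp_single hw]
      have e1 := LinearMap.congr_fun (hf i j hij) (Pi.single w 1)
      have e2 := LinearMap.congr_fun (hg i j hij) (Pi.single w 1)
      simp only [Module.End.mul_apply] at e1 e2
      rw [e1, e2, ih]
  refine (Pi.basisFun R (Perm (Fin r))).ext fun w => ?_
  simpa using key w

-- Compose left operators along a reduced word. By `RightComm.ext` the result does not depend on the
-- word, so no braid relations need checking.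
open Classical in
lemma exists_regular (w : Perm (Fin r)) :
    ∃ f : Module.End R (Perm (Fin r) → R), RightComm R f ∧
      f (Pi.single 1 1) = Pi.single w 1 := by
  induction w using left_induction with
  | one => exact ⟨1, fun _ _ _ => Commute.one_left _, rfl⟩
  | mul i j w hij hw ih =>
    obtain ⟨f, hf, h1⟩ := ih
    exact ⟨leftOp R i j * f, fun a b hab => (leftOp_comm_rightOp hij hab).mul_left (hf a b hab),
      by rw [Module.End.mul_apply, h1, leftOp_single hw]⟩

variable (R) in
/-- Left multiplication by `T_w`, in terms of coefficients. -/
noncomputable def regular (w : Perm (Fin r)) : Module.End R (Perm (Fin r) → R) :=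
  (exists_regular w).choose

lemma regular_comm (w : Perm (Fin r)) : RightComm R (regular R w) :=
  (exists_regular w).choose_spec.1

open Classical in
lemma regular_single_one (w : Perm (Fin r)) : regular R w (Pi.single 1 1) = Pi.single w 1 :=
  (exists_regular w).choose_spec.2

-- Additivity of length means that every letter of a reduced word of `w` lengthens the product when
-- appended to `y`.
open Classical in
lemma regular_single (y w : Perm (Fin r)) (h : len (y * w) = len y + len w) :
    regular R y (Pi.single w 1) = Pi.single (y * w) 1 := by
  induction w using right_induction with
  | one => rw [regular_single_one, mul_one]
  | mul i j w hij hw ih =>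
    rw [← rightOp_single hw]
    have e1 := LinearMap.congr_fun (regular_comm (R := R) y i j hij) (Pi.single w 1)
    simp only [Module.End.mul_apply] at e1
    rw [len_mul_swap hij hw, ← mul_assoc] at h
    have h1 := len_mul_le y w
    have h2 : (y * w) i < (y * w) j := by
      by_contra hc
      have := len_mul_swap' hij (lt_of_le_of_ne (not_lt.1 hc) ((y * w).injective.ne hij.lt.ne'))
      omega
    have h3 := len_mul_swap hij h2
    rw [e1, ih (by omega), rightOp_single h2, mul_assoc]

lemma regular_swap {i j : Fin r} (hij : Adj i j) : regular R (swap i j) = leftOp R i j := by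
  classical
  refine (regular_comm _).ext (fun a b hab => leftOp_comm_rightOp hij hab) ?_
  rw [regular_single_one, leftOp_single (by simpa using hij.lt), mul_one]

variable (r R) in
/-- The regular representation of the Hecke algebra, in terms of coefficients. -/
noncomputable def regularHom : Hecke r R →ₐ[R] Module.End R (Perm (Fin r) → R) :=
  RingQuot.liftAlgHom R ⟨FreeAlgebra.lift R (regular R), by
    classical
    intro x y h
    induction h with
    | one =>
      rw [FreeAlgebra.lift_ι_apply, map_one]
      exact (regular_comm 1).ext (fun _ _ _ => Commute.one_left _) (by rw [regular_single_one]; rfl)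
    | sq i j hij =>
      simp only [map_add, map_mul, map_smul, map_one, FreeAlgebra.lift_ι_apply, regular_swap hij]
      exact leftOp_sq hij
    | mul y w hl =>
      simp only [map_mul, FreeAlgebra.lift_ι_apply]
      refine RightComm.ext (fun a b hab => (regular_comm y a b hab).mul_left
        (regular_comm w a b hab)) (regular_comm _) ?_
      rw [Module.End.mul_apply, regular_single_one, regular_single_one, regular_single _ _ hl]⟩

lemma regularHom_heckeT (w : Perm (Fin r)) : regularHom r R (heckeT R w) = regular R w :=
  (RingQuot.liftAlgHom_mkAlgHom_apply R _ _ _).trans (FreeAlgebra.lift_ι_apply _ _)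

variable (r R) in
/-- The quotient map onto the Hecke algebra. -/
noncomputable def heckeMk : FreeAlgebra R (Perm (Fin r)) →ₐ[R] Hecke r R :=
  RingQuot.mkAlgHom R (HeckeRel r R)

lemma heckeMk_eq {x y : FreeAlgebra R (Perm (Fin r))} (h : HeckeRel r R x y) :
    heckeMk r R x = heckeMk r R y :=
  RingQuot.mkAlgHom_rel R h

lemma heckeMk_ι (w : Perm (Fin r)) : heckeMk r R (FreeAlgebra.ι R w) = heckeT R w := rfl

lemma heckeT_one : heckeT R (1 : Perm (Fin r)) = 1 :=
  (heckeMk_eq HeckeRel.one).trans (map_one _)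

lemma heckeT_mul {y w : Perm (Fin r)} (h : len (y * w) = len y + len w) :
    heckeT R y * heckeT R w = heckeT R (y * w) :=
  (map_mul (heckeMk r R) _ _).symm.trans (heckeMk_eq (HeckeRel.mul y w h))

lemma heckeT_sq {i j : Fin r} (hij : Adj i j) : heckeT R (swap i j) * heckeT R (swap i j) =
    ((qUnit R : R) - 1) • heckeT R (swap i j) + (qUnit R : R) • 1 := by
  have := heckeMk_eq (HeckeRel.sq (R := R) i j hij)
  simpa only [map_add, map_mul, map_smul, map_one, heckeMk_ι] using this

lemma heckeT_swap_mul {i j : Fin r} (hij : Adj i j) {w : Perm (Fin r)} (h : w⁻¹ i < w⁻¹ j) :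
    heckeT R (swap i j) * heckeT R w = heckeT R (swap i j * w) :=
  heckeT_mul (by rw [len_swap_mul hij h, len_swap hij, add_comm])

lemma heckeT_swap_mul' {i j : Fin r} (hij : Adj i j) {w : Perm (Fin r)} (h : w⁻¹ j < w⁻¹ i) :
    heckeT R (swap i j) * heckeT R w =
      ((qUnit R : R) - 1) • heckeT R w + (qUnit R : R) • heckeT R (swap i j * w) := by
  have e : heckeT R w = heckeT R (swap i j) * heckeT R (swap i j * w) := by
    rw [heckeT_swap_mul hij (by simpa using h), ← mul_assoc, swap_mul_self, one_mul]
  rw [e, ← mul_assoc, heckeT_sq hij, add_mul, smul_mul_assoc, smul_mul_assoc, one_mul]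

lemma heckeT_mul_mem (y w : Perm (Fin r)) :
    heckeT R y * heckeT R w ∈ Submodule.span R (Set.range (heckeT R : Perm (Fin r) → _)) := by
  induction y using left_induction generalizing w with
  | one =>
    rw [heckeT_one, one_mul]
    exact Submodule.subset_span ⟨w, rfl⟩
  | mul i j y hij hy ih =>
    rw [← heckeT_swap_mul hij hy, mul_assoc]
    refine Submodule.span_induction (p := fun x _ => heckeT R (swap i j) * x ∈ _) ?_ ?_ ?_ ?_ (ih w)
    · rintro _ ⟨x, rfl⟩
      rcases lt_or_gt_of_ne (x⁻¹.injective.ne hij.lt.ne) with h | h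
      · rw [heckeT_swap_mul hij h]
        exact Submodule.subset_span ⟨_, rfl⟩
      · rw [heckeT_swap_mul' hij h]
        exact add_mem (Submodule.smul_mem _ _ (Submodule.subset_span ⟨_, rfl⟩))
          (Submodule.smul_mem _ _ (Submodule.subset_span ⟨_, rfl⟩))
    · rw [mul_zero]
      exact zero_mem _
    · intro a b _ _ ha hb
      rw [mul_add]
      exact add_mem ha hb
    · intro a b _ hb
      rw [mul_smul_comm]
      exact Submodule.smul_mem _ _ hb

/-- The span contains `1` and is stable under left multiplication by the generators, hence by the
whole algebra. -/
lemma span_heckeT :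
    Submodule.span R (Set.range (heckeT R : Perm (Fin r) → Hecke r R)) = ⊤ := by
  set S := Submodule.span R (Set.range (heckeT R : Perm (Fin r) → Hecke r R))
  have key : ∀ a : FreeAlgebra R (Perm (Fin r)), ∀ h ∈ S, heckeMk r R a * h ∈ S := by
    intro a
    induction a with
    | grade0 c =>
      intro h hh
      rw [AlgHom.commutes, ← Algebra.smul_def]
      exact S.smul_mem _ hh
    | grade1 w =>
      intro h hh
      rw [heckeMk_ι]
      refine Submodule.span_induction (p := fun x _ => heckeT R w * x ∈ S) ?_ ?_ ?_ ?_ hh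
      · rintro _ ⟨x, rfl⟩
        exact heckeT_mul_mem w x
      · rw [mul_zero]
        exact zero_mem _
      · intro a b _ _ ha hb
        rw [mul_add]
        exact add_mem ha hb
      · intro a b _ hb
        rw [mul_smul_comm]
        exact Submodule.smul_mem _ _ hb
    | mul a b ha hb =>
      intro h hh
      rw [map_mul, mul_assoc]
      exact ha _ (hb _ hh)
    | add a b ha hb =>
      intro h hh
      rw [map_add, add_mul]
      exact add_mem (ha _ hh) (hb _ hh)
  refine eq_top_iff.2 fun x _ => ?_
  obtain ⟨a, rfl⟩ : ∃ a, heckeMk r R a = x := RingQuot.mkAlgHom_surjective R (HeckeRel r R) x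
  have := key a 1 (by rw [← heckeT_one]; exact Submodule.subset_span ⟨1, rfl⟩)
  rwa [mul_one] at this

open Classical in
variable (r R) in
/-- The coefficients of an element of the Hecke algebra. -/
noncomputable def coefHom : Hecke r R →ₗ[R] (Perm (Fin r) → R) :=
  LinearMap.applyₗ (Pi.single 1 1) ∘ₗ (regularHom r R).toLinearMap

open Classical in
lemma coefHom_heckeT (w : Perm (Fin r)) : coefHom r R (heckeT R w) = Pi.single w 1 := by
  change regularHom r R (heckeT R w) (Pi.single 1 1) = _
  rw [regularHom_heckeT, regular_single_one]

variable (R) in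
/-- The basis `T_w` of the Hecke algebra. -/
noncomputable def heckeBasis : Module.Basis (Perm (Fin r)) R (Hecke r R) :=
  Module.Basis.mk (v := heckeT R) (by
    classical
    refine LinearIndependent.of_comp (coefHom r R) ?_
    have : coefHom r R ∘ heckeT R = Pi.basisFun R (Perm (Fin r)) := by
      ext w : 1
      rw [Function.comp_apply, coefHom_heckeT, Pi.basisFun_apply]
    rw [this]
    exact (Pi.basisFun R (Perm (Fin r))).linearIndependent) span_heckeT.ge

lemma heckeBasis_apply (w : Perm (Fin r)) : heckeBasis R w = heckeT R w :=
  Module.Basis.mk_apply _ _ _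

variable (r R) in
/-- An element of the Hecke algebra is given by its coefficients. -/
noncomputable def coef : Hecke r R ≃ₗ[R] (Perm (Fin r) → R) := (heckeBasis R).equivFun

open Classical in
lemma coef_heckeT (w : Perm (Fin r)) : coef r R (heckeT R w) = Pi.single w 1 := by
  rw [← heckeBasis_apply]
  ext x
  simp [coef, Pi.single_apply, eq_comm]

lemma sum_coef (h : Hecke r R) : ∑ w, coef r R h w • heckeT R w = h := by
  have := (heckeBasis R).sum_equivFun h
  simp only [heckeBasis_apply] at this
  exact this

/-- Coordinates in the basis are values of the regular representation at the unit vector; left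
multiplication by `T_s` thus becomes `leftOp` on coefficients. -/
lemma coef_eq (h : Hecke r R) : coef r R h = coefHom r R h := by
  classical
  suffices (coef r R).toLinearMap = coefHom r R from LinearMap.congr_fun this h
  refine (heckeBasis R).ext fun w => ?_
  rw [heckeBasis_apply, LinearEquiv.coe_coe, coef_heckeT, coefHom_heckeT]

lemma coef_swap_mul {i j : Fin r} (hij : Adj i j) (h : Hecke r R) :
    coef r R (heckeT R (swap i j) * h) = leftOp R i j (coef r R h) := by
  rw [coef_eq, coef_eq]
  change regularHom r R (_ * h) _ = leftOp R i j (regularHom r R h _)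
  rw [map_mul, regularHom_heckeT, regular_swap hij]
  rfl

/-! ### The anti-involution and change of the base ring -/

variable (r R) in
/-- The anti-automorphism `T_w ↦ T_(w⁻¹)` of the Hecke algebra. -/
noncomputable def heckeOp : Hecke r R →ₐ[R] (Hecke r R)ᵐᵒᵖ :=
  RingQuot.liftAlgHom R ⟨FreeAlgebra.lift R fun w => MulOpposite.op (heckeT R w⁻¹), by
    intro x y h
    induction h with
    | one => rw [FreeAlgebra.lift_ι_apply, map_one, inv_one, heckeT_one, MulOpposite.op_one]
    | sq i j hij =>
      simp only [map_add, map_mul, map_smul, map_one, FreeAlgebra.lift_ι_apply, swap_inv,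
        ← MulOpposite.op_mul, heckeT_sq hij]
      rfl
    | mul y w hl =>
      simp only [map_mul, FreeAlgebra.lift_ι_apply, ← MulOpposite.op_mul, mul_inv_rev]
      rw [heckeT_mul]
      rw [← mul_inv_rev, len_inv, len_inv, len_inv, hl, add_comm]⟩

variable (r R) in
/-- The anti-automorphism `T_w ↦ T_(w⁻¹)` as a linear map. -/
noncomputable def heckeInv : Hecke r R →ₗ[R] Hecke r R :=
  (MulOpposite.opLinearEquiv R).symm.toLinearMap ∘ₗ (heckeOp r R).toLinearMap

lemma heckeInv_heckeT (w : Perm (Fin r)) : heckeInv r R (heckeT R w) = heckeT R w⁻¹ :=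
  congrArg MulOpposite.unop
    ((RingQuot.liftAlgHom_mkAlgHom_apply R _ _ _).trans (FreeAlgebra.lift_ι_apply _ _))

lemma heckeInv_mul (a b : Hecke r R) : heckeInv r R (a * b) = heckeInv r R b * heckeInv r R a :=
  congrArg MulOpposite.unop (map_mul (heckeOp r R) a b)

lemma coef_heckeInv (h : Hecke r R) (w : Perm (Fin r)) :
    coef r R (heckeInv r R h) w = coef r R h w⁻¹ := by
  classical
  conv_lhs => rw [← sum_coef h]
  simp only [map_sum, map_smul, heckeInv_heckeT, coef_heckeT, Finset.sum_apply, Pi.smul_apply,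
    Pi.single_apply, smul_eq_mul, mul_ite, mul_one, mul_zero]
  rw [Finset.sum_eq_single w⁻¹]
  · simp
  · intro x _ hx
    rw [if_neg]
    rintro rfl
    simp at hx
  · simp

lemma heckeInv_heckeInv (h : Hecke r R) : heckeInv r R (heckeInv r R h) = h := by
  refine (coef r R).injective (funext fun w => ?_)
  rw [coef_heckeInv, coef_heckeInv, inv_inv]

lemma qUnit_map : algebraMap ℤ[T;T⁻¹] R (qUnit ℤ[T;T⁻¹] : ℤ[T;T⁻¹]) = qUnit R := by
  simp only [qUnit, Units.val_pow_eq_pow_val, map_pow]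
  rfl

lemma negq_map (k : ℕ) : algebraMap ℤ[T;T⁻¹] R (negq ℤ[T;T⁻¹] k) = negq R k := by
  have h : Units.map (algebraMap ℤ[T;T⁻¹] R : ℤ[T;T⁻¹] →* R) (-qUnit ℤ[T;T⁻¹]) = -qUnit R := by
    ext
    simp [qUnit_map]
  rw [negq, negq, ← h, ← map_zpow]
  rfl

variable (r R) in
/-- The homomorphism of Hecke algebras given by a change of the base ring. -/
noncomputable def heckeMap : Hecke r ℤ[T;T⁻¹] →+* Hecke r R :=
  -- The universal property of the generic algebra applies once the target is an algebra over
  -- Laurent polynomials by restriction of scalars.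
  letI : Algebra ℤ[T;T⁻¹] (Hecke r R) := Algebra.compHom _ (algebraMap ℤ[T;T⁻¹] R)
  (RingQuot.liftAlgHom ℤ[T;T⁻¹] ⟨FreeAlgebra.lift ℤ[T;T⁻¹] (heckeT R), by
    intro x y h
    induction h with
    | one => rw [FreeAlgebra.lift_ι_apply, map_one, heckeT_one]
    | sq i j hij =>
      simp only [map_add, map_mul, map_smul, map_one, FreeAlgebra.lift_ι_apply, heckeT_sq hij]
      rw [← qUnit_map, ← map_one (algebraMap ℤ[T;T⁻¹] R), ← map_sub]
      rfl
    | mul y w hl =>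
      simp only [map_mul, FreeAlgebra.lift_ι_apply, heckeT_mul hl]⟩ :
      Hecke r ℤ[T;T⁻¹] →ₐ[ℤ[T;T⁻¹]] Hecke r R).toRingHom

lemma heckeMap_heckeT (w : Perm (Fin r)) : heckeMap r R (heckeT _ w) = heckeT R w :=
  letI : Algebra ℤ[T;T⁻¹] (Hecke r R) := Algebra.compHom _ (algebraMap ℤ[T;T⁻¹] R)
  (RingQuot.liftAlgHom_mkAlgHom_apply ℤ[T;T⁻¹] _ _ _).trans (FreeAlgebra.lift_ι_apply _ _)

lemma heckeMap_smul (a : ℤ[T;T⁻¹]) (h : Hecke r ℤ[T;T⁻¹]) :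
    heckeMap r R (a • h) = algebraMap ℤ[T;T⁻¹] R a • heckeMap r R h := by
  let : Algebra ℤ[T;T⁻¹] (Hecke r R) := Algebra.compHom _ (algebraMap ℤ[T;T⁻¹] R)
  rw [Algebra.smul_def, map_mul, Algebra.smul_def]
  congr 1
  exact AlgHom.commutes (RingQuot.liftAlgHom ℤ[T;T⁻¹] _ : Hecke r ℤ[T;T⁻¹] →ₐ[_] Hecke r R) a

end HeckeBasis

/-! ### Elements with a sign behaviour under left multiplication -/

section Signed

variable {m n r : ℕ} (R : Type*) [CommRing R] [Algebra ℤ[T;T⁻¹] R]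

lemma negq_zero : negq R 0 = 1 := by simp [negq]

lemma negq_add (k l : ℕ) : negq R (k + l) = negq R k * negq R l := by
  rw [negq, negq, negq, ← Units.val_mul, ← zpow_add]
  congr 2
  push_cast
  ring

lemma qUnit_mul_negq : (qUnit R : R) * negq R 1 = -1 := by
  have h : (qUnit R) * (-qUnit R) ^ (-((1 : ℕ) : ℤ)) = -1 := by
    rw [Nat.cast_one, zpow_neg, zpow_one, mul_inv_eq_iff_eq_mul, neg_mul, one_mul, neg_neg]
  exact (congrArg Units.val h).trans (by rw [Units.val_neg, Units.val_one])

/-- The scalar by which `T_s` acts, for `s` in the `i`-th row. -/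
noncomputable def chi (i : Fin (m + n)) : R := if hat m n i = 1 then -1 else qUnit R

/-- The ratio of the coefficients of `T_(s w)` and `T_w`, for `s` in the `i`-th row. -/
noncomputable def sgn (i : Fin (m + n)) : R := if hat m n i = 1 then negq R 1 else 1

lemma qUnit_mul_sgn (i : Fin (m + n)) : (qUnit R : R) * sgn R i = chi R i := by
  unfold sgn chi
  split_ifs
  · exact qUnit_mul_negq R
  · exact mul_one _

/-- This is the quadratic relation `χ² = (q - 1) χ + q` divided by `q`. -/
lemma one_add_mul_sgn (i : Fin (m + n)) :
    1 + ((qUnit R : R) - 1) * sgn R i = chi R i * sgn R i := by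
  unfold sgn chi
  split_ifs
  · linear_combination qUnit_mul_negq R
  · ring

variable {R}

/-- The right multiples of `x_lam y_mu`, by their behaviour under left multiplication. -/
def LeftSgn (ν : Weight m n r) (h : Hecke r R) : Prop :=
  ∀ i j, Adj i j → ν.idx i = ν.idx j → heckeT R (swap i j) * h = chi R (ν.idx i) • h

variable {ν ρ : Weight m n r} {h h' : Hecke r R}

/-- Compare coefficients at `w` and `s w`. At the shorter one the equation is the stated ratio
multiplied by the unit `q`; at the longer one it then follows from the quadratic relation. -/
lemma leftSgn_iff : LeftSgn ν h ↔ ∀ i j, Adj i j → ν.idx i = ν.idx j → ∀ w : Perm (Fin r),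
    w⁻¹ i < w⁻¹ j → coef r R h (swap i j * w) = sgn R (ν.idx i) * coef r R h w := by
  refine forall_congr' fun i => forall_congr' fun j => forall_congr' fun hij =>
    forall_congr' fun _ => ?_
  rw [← (coef r R).injective.eq_iff, coef_swap_mul hij, map_smul]
  constructor
  · intro hc w hw
    have := congrFun hc w
    rw [leftOp_apply, if_pos hw, Pi.smul_apply, smul_eq_mul, ← qUnit_mul_sgn, mul_assoc] at this
    exact (qUnit R).isUnit.mul_left_cancel this
  · refine fun hc => funext fun w => ?_
    rw [leftOp_apply, Pi.smul_apply, smul_eq_mul]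
    split_ifs with hw
    · rw [hc w hw, ← mul_assoc, qUnit_mul_sgn]
    · have hlt := lt_of_le_of_ne (not_lt.1 hw) (w⁻¹.injective.ne hij.lt.ne')
      have := hc (swap i j * w) (by simpa using hlt)
      rw [← mul_assoc, swap_mul_self, one_mul] at this
      rw [this]
      linear_combination coef r R h (swap i j * w) * one_add_mul_sgn R (ν.idx i)

lemma LeftSgn.mul_right (hh : LeftSgn ν h) (b : Hecke r R) : LeftSgn ν (h * b) :=
  fun i j hij hrow => by rw [← mul_assoc, hh i j hij hrow, smul_mul_assoc]

lemma LeftSgn.sub (hh : LeftSgn ν h) (hh' : LeftSgn ν h') : LeftSgn ν (h - h') :=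
  fun i j hij hrow => by rw [mul_sub, hh i j hij hrow, hh' i j hij hrow, smul_sub]

/-- Such a `w` can be shortened by some `s` inside a row, and its coefficient is a multiple of the
one at `s w`. -/
lemma LeftSgn.coef_eq_zero (hh : LeftSgn ν h) {w : Perm (Fin r)} (hw : ¬RowInc ν w⁻¹)
    (ih : ∀ w', len w' < len w → coef r R h w' = 0) : coef r R h w = 0 := by
  obtain ⟨i, j, hij, hrow, hlt⟩ : ∃ i j, Adj i j ∧ ν.idx i = ν.idx j ∧ w⁻¹ j < w⁻¹ i := by
    by_contra! hc
    exact hw (rowInc_of_adj fun i j hij hrow =>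
      lt_of_le_of_ne (hc i j hij hrow) (w⁻¹.injective.ne hij.lt.ne))
  have := leftSgn_iff.1 hh i j hij hrow (swap i j * w) (by simpa using hlt)
  rw [ih (swap i j * w) (by have := len_swap_mul' hij hlt; omega), mul_zero, ← mul_assoc,
    swap_mul_self, one_mul] at this
  exact this

lemma LeftSgn.eq_zero (hh : LeftSgn ν h) (h0 : ∀ w, RowInc ν w⁻¹ → coef r R h w = 0) : h = 0 := by
  refine (coef r R).map_eq_zero_iff.1 (funext fun w => ?_)
  induction hl : len w using Nat.strong_induction_on generalizing w with
  | _ l ih =>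
    by_cases hw : RowInc ν w⁻¹
    · exact h0 w hw
    · exact hh.coef_eq_zero hw fun w' hw' => ih _ (hl ▸ hw') w' rfl

/-! ### Sums over double cosets -/

variable (R) in
open Classical in
/-- The sum of the `(-q) ^ (-stat w) T_w` over the double coset with matrix `A`. -/
noncomputable def dElt (ν ρ : Weight m n r) (A : SMat m n r) : Hecke r R :=
  ∑ w ∈ Finset.univ.filter (fun w => jmat ν w ρ = A.1), negq R (stat ν ρ w) • heckeT R w

open Classical in
lemma coef_sum_smul (s : Finset (Perm (Fin r))) (c : Perm (Fin r) → R) (w : Perm (Fin r)) :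
    coef r R (∑ x ∈ s, c x • heckeT R x) w = if w ∈ s then c w else 0 := by
  simp only [map_sum, map_smul, coef_heckeT, Finset.sum_apply, Pi.smul_apply, Pi.single_apply,
    smul_eq_mul, mul_ite, mul_one, mul_zero]
  exact Finset.sum_ite_eq s w c

open Classical in
lemma coef_dElt (A : SMat m n r) (w : Perm (Fin r)) :
    coef r R (dElt R ν ρ A) w = if jmat ν w ρ = A.1 then negq R (stat ν ρ w) else 0 := by
  rw [dElt, coef_sum_smul]
  simp

lemma heckeInv_dElt (A : SMat m n r) : heckeInv r R (dElt R ν ρ A) = dElt R ρ ν A.transpose := by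
  refine (coef r R).injective (funext fun w => ?_)
  rw [coef_heckeInv, coef_dElt, coef_dElt, stat_inv, jmat_inv]
  congr 1
  rw [eq_iff_iff, ← Matrix.transpose_inj, Matrix.transpose_transpose]
  rfl

lemma heckeMap_dElt (A : SMat m n r) : heckeMap r R (dElt ℤ[T;T⁻¹] ν ρ A) = dElt R ν ρ A := by
  simp only [dElt, map_sum, heckeMap_smul, heckeMap_heckeT, negq_map]

/-- Multiplication by `s` stays in the double coset, and the change of `stat` produces exactly the
required ratio. The statement on the right follows through `heckeInv_dElt`. -/
lemma leftSgn_dElt (A : SMat m n r) : LeftSgn ν (dElt R ν ρ A) := by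
  refine leftSgn_iff.2 fun i j hij hrow w hw => ?_
  rw [coef_dElt, coef_dElt, jmat_mul_left _ _ (swap_mem_young hrow)]
  split_ifs with hA
  · have hA' : jmat ρ w⁻¹ ν = A.transpose.1 := by rw [jmat_inv, hA]; rfl
    rw [← stat_inv, mul_inv_rev, swap_inv, stat_mul_swap hA' hij hrow hw, stat_inv, negq_add,
      mul_comm, sgn]
    split_ifs
    · rfl
    · rw [negq_zero]
  · rw [mul_zero]

/-- The diagonal matrix with the entries of `ν`. -/
def Weight.diag (ν : Weight m n r) : SMat m n r :=
  ⟨Matrix.diagonal ν.1, fun i j hij => Or.inl (Matrix.diagonal_apply_ne _ (by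
    rintro rfl
    rcases hat_eq_zero_or_one m n i with h | h <;> rw [h] at hij <;> revert hij <;> decide)), by
    simpa [Matrix.diagonal_apply] using ν.2⟩

lemma Weight.diag_transpose (ν : Weight m n r) : ν.diag.transpose = ν.diag :=
  Subtype.ext (Matrix.diagonal_transpose _)

lemma jmat_one (ν : Weight m n r) : jmat ν 1 ν = ν.diag.1 := by
  ext i j
  rw [jmat_apply]
  change _ = Matrix.diagonal ν.1 i j
  rw [Matrix.diagonal_apply]
  split_ifs with hij
  · rw [← ν.card_row, hij]
    congr 1
    ext k
    simp [Weight.mem_row]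
  · rw [Finset.card_eq_zero, Finset.filter_eq_empty_iff]
    rintro k - ⟨rfl, h⟩
    exact hij h.symm

lemma jmat_eq_diag_iff {w : Perm (Fin r)} : jmat ν w ν = ν.diag.1 ↔ w ∈ young ν := by
  refine ⟨fun h => mem_young.2 fun k => ?_, fun h => ?_⟩
  · by_contra hne
    have h1 := congrFun (congrFun h (ν.idx (w k))) (ν.idx k)
    rw [jmat_apply, show ν.diag.1 (ν.idx (w k)) (ν.idx k) = 0 from
      Matrix.diagonal_apply_ne _ hne, Finset.card_eq_zero, Finset.filter_eq_empty_iff] at h1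
    exact h1 (Finset.mem_univ k) ⟨rfl, rfl⟩
  · rw [← mul_one w, jmat_mul_left ν ν h, jmat_one]

-- Young subgroup elements factor uniquely as `u * v` with additive lengths and `stat` equal to `len
-- v`. The generator is therefore a double coset sum, and all facts on `dElt` apply to it.
open Classical in
lemma xyElt_eq (ν : Weight m n r) : xyElt R ν = dElt R ν ν ν.diag := by
  rw [xyElt, xElt, yElt, Finset.sum_mul_sum, ← Finset.sum_product', dElt]
  refine Finset.sum_bij (fun p _ => p.1 * p.2) ?_ ?_ ?_ ?_
  · intro p hp
    simp only [Finset.mem_product, Finset.mem_filter, Finset.mem_univ, true_and] at hp ⊢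
    exact jmat_eq_diag_iff.2 (mul_mem (mem_youngPart.1 hp.1).1 (mem_youngPart.1 hp.2).1)
  · intro p hp p' hp' he
    simp only [Finset.mem_product, Finset.mem_filter, Finset.mem_univ, true_and] at hp hp'
    exact Prod.ext_iff.2 (youngPart_eq hp.1 hp.2 hp'.1 hp'.2 he)
  · intro w hw
    simp only [Finset.mem_filter, Finset.mem_univ, true_and] at hw
    obtain ⟨u, hu, v, hv, rfl⟩ := exists_youngPart (jmat_eq_diag_iff.1 hw)
    exact ⟨(u, v), by simp [hu, hv], rfl⟩
  · intro p hp
    simp only [Finset.mem_product, Finset.mem_filter, Finset.mem_univ, true_and] at hp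
    rw [mul_smul_comm, heckeT_mul (len_youngPart_mul hp.1 hp.2), stat_young hp.1 hp.2]

lemma leftSgn_xyElt (ν : Weight m n r) : LeftSgn ν (xyElt R ν) := by
  rw [xyElt_eq]
  exact leftSgn_dElt _

lemma heckeInv_xyElt (ν : Weight m n r) : heckeInv r R (xyElt R ν) = xyElt R ν := by
  rw [xyElt_eq, heckeInv_dElt, Weight.diag_transpose]

lemma heckeMap_xyElt (ν : Weight m n r) : heckeMap r R (xyElt ℤ[T;T⁻¹] ν) = xyElt R ν := by
  rw [xyElt_eq, heckeMap_dElt, xyElt_eq]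

-- Here `T_w T_d = T_(w d)` for `w` in the Young subgroup, and `w d` is shortest in its coset only
-- for `w = 1`.
open Classical in
lemma coef_xyElt_mul_heckeT {d d' : Perm (Fin r)} (hd : RowInc ν d⁻¹) (hd' : RowInc ν d'⁻¹) :
    coef r R (xyElt R ν * heckeT R d) d' = if d' = d then 1 else 0 := by
  rw [xyElt_eq, dElt, Finset.sum_mul, map_sum, Finset.sum_apply, Finset.sum_eq_single 1]
  · rw [stat_eq_zero (fun a b h _ => h) (fun a b h _ => by simpa using h), negq_zero, one_smul,
      heckeT_one, one_mul, coef_heckeT, Pi.single_apply]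
  · intro w hw hne
    simp only [Finset.mem_filter, Finset.mem_univ, true_and, jmat_eq_diag_iff] at hw
    rw [smul_mul_assoc, heckeT_mul (len_young_mul hw hd), map_smul, coef_heckeT, Pi.smul_apply,
      Pi.single_eq_of_ne, smul_zero]
    exact fun hc => hne (eq_of_rowInc hw hd hd' hc.symm)
  · intro hc
    exact absurd (by simp [jmat_one]) hc

lemma coef_xyElt_mul {b : Hecke r R} (hb : ∀ d, ¬RowInc ν d⁻¹ → coef r R b d = 0)
    {d : Perm (Fin r)} (hd : RowInc ν d⁻¹) : coef r R (xyElt R ν * b) d = coef r R b d := by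
  conv_lhs => rw [← sum_coef b]
  rw [Finset.mul_sum, map_sum, Finset.sum_apply, Finset.sum_eq_single d]
  · rw [mul_smul_comm, map_smul, Pi.smul_apply, coef_xyElt_mul_heckeT hd hd, if_pos rfl,
      smul_eq_mul, mul_one]
  · intro d' _ hne
    rw [mul_smul_comm, map_smul, Pi.smul_apply, smul_eq_mul]
    by_cases hd' : RowInc ν d'⁻¹
    · rw [coef_xyElt_mul_heckeT hd' hd, if_neg hne.symm, mul_zero]
    · rw [hb _ hd', zero_mul]
  · simp

/-- Take for `b` the part of `h` supported on shortest representatives: `x y b` and `h` agree there,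
hence everywhere. No division is involved, so this holds over every `R`. -/
lemma LeftSgn.exists_eq_mul (hh : LeftSgn ν h) : ∃ b, h = xyElt R ν * b := by
  classical
  let b := (coef r R).symm fun d => if RowInc ν d⁻¹ then coef r R h d else 0
  have hb : ∀ d, coef r R b d = if RowInc ν d⁻¹ then coef r R h d else 0 := fun d => by
    rw [LinearEquiv.apply_symm_apply]
  refine ⟨b, sub_eq_zero.1 ((hh.sub ((leftSgn_xyElt ν).mul_right b)).eq_zero fun d hd => ?_)⟩
  rw [map_sub, Pi.sub_apply, coef_xyElt_mul (fun d hd => by rw [hb, if_neg hd]) hd, hb, if_pos hd,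
    sub_self]

lemma exists_eq_mul_xyElt (hh : LeftSgn ν (heckeInv r R h)) : ∃ a, h = a * xyElt R ν := by
  obtain ⟨b, hb⟩ := hh.exists_eq_mul
  refine ⟨heckeInv r R b, ?_⟩
  rw [← heckeInv_heckeInv h, hb, heckeInv_mul, heckeInv_xyElt]

lemma SMat.heckeT_rep_mul {A : SMat m n r} {u v : Perm (Fin r)} (hu : u ∈ youngPart 0 A.co)
    (hv : v ∈ youngPart 1 A.co) :
    heckeT R A.rep * heckeT R u * heckeT R v = heckeT R (A.rep * (u * v)) := by
  rw [mul_assoc, heckeT_mul (len_youngPart_mul hu hv), heckeT_mul]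
  exact len_mul_young (mul_mem (mem_youngPart.1 hu).1 (mem_youngPart.1 hv).1) A.rowInc_rep

-- The sum defining `T_D` is `x y b`, where `b` runs over the elements of the double coset that are
-- shortest in their left Young cosets. Both sides have the same sign behaviour, so it suffices to
-- compare coefficients at shortest representatives.
open Classical in
lemma SMat.TD_eq (A : SMat m n r) : A.TD R = dElt R A.ro A.co A := by
  let S := Finset.univ.filter fun e => RowInc A.ro e⁻¹ ∧ jmat A.ro e A.co = A.1
  let b : Hecke r R := ∑ e ∈ S, negq R (stat A.ro A.co e) • heckeT R e
  have hTD : A.TD R = xyElt R A.ro * b := by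
    rw [SMat.TD, Finset.mul_sum]
    refine Finset.sum_bij (fun p _ => A.rep * (p.1 * p.2)) ?_ ?_ ?_ ?_
    · intro p hp
      simp only [S, Finset.mem_filter, Finset.mem_univ, true_and] at hp ⊢
      have hx := mul_mem (mem_youngPart.1 hp.1).1 (mem_youngPart.1 hp.2.1).1
      exact ⟨(SMat.mem_minReps_inter hx).1 hp.2.2, by rw [jmat_mul_right _ _ hx, A.jmat_rep]⟩
    · intro p hp p' hp' he
      simp only [Finset.mem_filter, Finset.mem_univ, true_and] at hp hp'
      exact Prod.ext_iff.2 (youngPart_eq hp.1 hp.2.1 hp'.1 hp'.2.1 (mul_left_cancel he))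
    · intro e he
      simp only [S, Finset.mem_filter, Finset.mem_univ, true_and] at he
      obtain ⟨x, hx, rfl⟩ := SMat.exists_eq_rep_mul he.2 he.1
      obtain ⟨u, hu, v, hv, rfl⟩ := exists_youngPart hx
      refine ⟨(u, v), ?_, rfl⟩
      simp only [Finset.mem_filter, Finset.mem_univ, true_and]
      exact ⟨hu, hv, (SMat.mem_minReps_inter hx).2 he.1⟩
    · intro p hp
      simp only [Finset.mem_filter, Finset.mem_univ, true_and] at hp
      have hx := mul_mem (mem_youngPart.1 hp.1).1 (mem_youngPart.1 hp.2.1).1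
      rw [mul_smul_comm, stat_mul_young A.rowInc_rep hp.1 hp.2.1
        ((SMat.mem_minReps_inter hx).1 hp.2.2), ← SMat.heckeT_rep_mul hp.1 hp.2.1]
      simp only [mul_assoc]
  have hb : ∀ e, coef r R b e =
      if RowInc A.ro e⁻¹ ∧ jmat A.ro e A.co = A.1 then negq R (stat A.ro A.co e) else 0 :=
    fun e => by
      rw [coef_sum_smul]
      simp [S]
  rw [hTD]
  refine sub_eq_zero.1 ((((leftSgn_xyElt A.ro).mul_right b).sub (leftSgn_dElt A)).eq_zero
    fun d hd => ?_)
  rw [map_sub, Pi.sub_apply, coef_xyElt_mul (fun d hd => by rw [hb, if_neg fun hc => hd hc.1]) hd,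
    hb, coef_dElt]
  simp only [hd, true_and, sub_self]

open Classical in
lemma coef_dElt_rep (A B : SMat m n r) :
    coef r R (dElt R A.ro A.co B) A.rep = if A = B then 1 else 0 := by
  rw [coef_dElt, A.jmat_rep, stat_eq_zero A.rowInc_rep A.rowInc_rep_inv, negq_zero]
  congr 1
  exact propext Subtype.ext_iff.symm

/-! ### Elements determined by their coefficients at shortest double coset representatives -/

lemma sum_jmat_row (ν : Weight m n r) (w : Perm (Fin r)) (ρ : Weight m n r) (i : Fin (m + n)) :
    ∑ j, jmat ν w ρ i j = ν.1 i := by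
  have : ∀ j, jmat ν w ρ i j =
      ((Finset.univ.filter fun p => ν.idx (w p) = i).filter fun p => ρ.idx p = j).card :=
    fun j => by
      rw [jmat_apply, Finset.filter_filter]
      simp only [and_comm]
  simp only [this]
  rw [← Finset.card_eq_sum_card_fiberwise (fun _ _ => Finset.mem_coe.2 (Finset.mem_univ _)),
    ← ν.card_row, ← Finset.card_map w.toEmbedding]
  congr 1
  ext k
  simp only [Finset.mem_map, Finset.mem_filter, Finset.mem_univ, true_and, Weight.mem_row,
    Equiv.coe_toEmbedding]
  exact ⟨by rintro ⟨a, ha, rfl⟩; exact ha, fun hk => ⟨w⁻¹ k, by simpa using hk, by simp⟩⟩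

lemma sum_jmat_col (ν : Weight m n r) (w : Perm (Fin r)) (ρ : Weight m n r) (j : Fin (m + n)) :
    ∑ i, jmat ν w ρ i j = ρ.1 j := by
  rw [← sum_jmat_row ρ w⁻¹ ν, jmat_inv]
  rfl

lemma exists_sMat {w : Perm (Fin r)}
    (h : ∀ i j, hat m n i + hat m n j = 1 → jmat ν w ρ i j = 0 ∨ jmat ν w ρ i j = 1) :
    ∃ A : SMat m n r, jmat ν w ρ = A.1 ∧ A.ro = ν ∧ A.co = ρ :=
  ⟨⟨jmat ν w ρ, h, by simp only [sum_jmat_row, ν.2]⟩, rfl,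
    Subtype.ext (funext fun i => sum_jmat_row ν w ρ i),
    Subtype.ext (funext fun j => sum_jmat_col ν w ρ j)⟩

/-- By induction on length: an element that can be shortened on either side inherits the value zero,
a shortest one with an admissible matrix is some `A.rep`, and an inadmissible matrix forces `(1 + q)
c = 0`. -/
lemma eq_zero_of_coef_rep
    (hR : 0 < m → 0 < n → 2 ≤ r → 1 + (vUnit R : R) ^ 2 ∈ nonZeroDivisors R)
    (hl : LeftSgn ν h) (hr : LeftSgn ρ (heckeInv r R h))
    (h0 : ∀ A : SMat m n r, A.ro = ν → A.co = ρ → coef r R h A.rep = 0) : h = 0 := by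
  refine (coef r R).map_eq_zero_iff.1 (funext fun w => ?_)
  induction hlen : len w using Nat.strong_induction_on generalizing w with
  | _ l ih =>
    by_cases h1 : RowInc ν w⁻¹
    swap
    · exact hl.coef_eq_zero h1 fun w' hw' => ih _ (hlen ▸ hw') w' rfl
    by_cases h2 : RowInc ρ w
    swap
    · have := hr.coef_eq_zero (w := w⁻¹) (by rwa [inv_inv]) fun w' hw' => by
        rw [coef_heckeInv]
        exact ih _ (by rwa [len_inv, ← hlen, ← len_inv w]) w'⁻¹ rfl
      rwa [coef_heckeInv, inv_inv] at this
    by_cases hM : ∀ i j, hat m n i + hat m n j = 1 → jmat ν w ρ i j = 0 ∨ jmat ν w ρ i j = 1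
    · obtain ⟨A, hA, rfl, rfl⟩ := exists_sMat hM
      rw [SMat.eq_rep h2 h1 hA]
      exact h0 A rfl rfl
    · push Not at hM
      obtain ⟨i, j, hij, hne0, hne1⟩ := hM
      obtain ⟨p, p', hadj, hadj', hp, hp', hwp, hwp'⟩ :=
        exists_adj_of_two_le (ν := ν) (ρ := ρ) h2 h1 (i := i) (j := j) (by omega)
      have e1 := leftSgn_iff.1 hl _ _ hadj' (hwp.trans hwp'.symm) w (by simpa using hadj.lt)
      have e2 := leftSgn_iff.1 hr _ _ hadj (hp.trans hp'.symm) w⁻¹ (by simpa using hadj'.lt)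
      -- Both transpositions give the same element `s w = w t`, so the left and the right condition
      -- evaluate one and the same coefficient.
      rw [coef_heckeInv, coef_heckeInv, mul_inv_rev, inv_inv, swap_inv, mul_swap_eq_swap_mul, e1,
        hwp, hp] at e2
      have e3 : (1 + (qUnit R : R)) * coef r R h w = 0 := by
        have hq := qUnit_mul_negq R
        unfold sgn at e2
        rcases hat_eq_zero_or_one m n i with hi | hi <;>
          rcases hat_eq_zero_or_one m n j with hj | hj <;> rw [hi, hj] at hij e2
        · exact absurd hij (by decide)
        · rw [if_neg (by decide), if_pos rfl] at e2
          linear_combination (qUnit R : R) * e2 + coef r R h w * hq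
        · rw [if_pos rfl, if_neg (by decide)] at e2
          linear_combination -(qUnit R : R) * e2 + coef r R h w * hq
        · exact absurd hij (by decide)
      -- The bad block meets rows of both parities and contains two points, so the hypothesis on `1
      -- + v ^ 2` is available.
      have hm : 0 < m ∧ 0 < n := by
        have := i.2
        have := j.2
        unfold hat at hij
        split_ifs at hij <;> first | omega | exact absurd hij (by decide)
      have hr2 : 2 ≤ r := by
        have := Fin.lt_def.1 hadj.lt
        have := p'.2
        omega
      have := hR hm.1 hm.2 hr2
      rw [show (vUnit R : R) ^ 2 = qUnit R by simp [qUnit]] at this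
      exact (mem_nonZeroDivisors_iff.1 this).1 _ e3

end Signed

/-! ### Endomorphisms as matrices over the Hecke algebra -/

section Entries

variable {m n r : ℕ} {R : Type*} [CommRing R] [Algebra ℤ[T;T⁻¹] R] {κ ν : Weight m n r}

lemma SignedPerm.val_injective : Function.Injective (SignedPerm.val (R := R) (ν := ν)) :=
  Subtype.val_injective

lemma SignedPerm.val_mk (h : Hecke r R) : (SignedPerm.mk R ν h).val = xyElt R ν * h := rfl

lemma SignedPerm.exists_mk (x : SignedPerm R ν) : ∃ h, x = SignedPerm.mk R ν h := by
  obtain ⟨h, hx⟩ := Submodule.mem_span_singleton.1 x.2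
  exact ⟨h.unop, Subtype.ext hx.symm⟩

/-- The component in `x_κ y_κ H` of the image of the generator of `x_ν y_ν H`. -/
noncomputable def entry (f : EndH m n r R) (κ ν : Weight m n r) : Hecke r R :=
  (f (Pi.single ν (SignedPerm.mk R ν 1)) κ).val

lemma entry_mul_right (f : EndH m n r R) (κ ν : Weight m n r) (h : Hecke r R) :
    (f (Pi.single ν (SignedPerm.mk R ν h)) κ).val = entry f κ ν * h := by
  have e : Pi.single (M := fun ν => SignedPerm R ν) ν (SignedPerm.mk R ν h) =
      MulOpposite.op h • Pi.single ν (SignedPerm.mk R ν 1) := by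
    rw [← Pi.single_smul]
    congr 1
    refine SignedPerm.val_injective ?_
    rw [map_smul, SignedPerm.val_mk, SignedPerm.val_mk, mul_one]
    rfl
  rw [e, map_smul, Pi.smul_apply, map_smul]
  rfl

lemma entry_ext {f g : EndH m n r R} (h : ∀ κ ν, entry f κ ν = entry g κ ν) : f = g := by
  have := Fintype.ofFinite (Weight m n r)
  refine LinearMap.pi_ext fun ν x => ?_
  obtain ⟨a, rfl⟩ := SignedPerm.exists_mk x
  funext κ
  refine SignedPerm.val_injective ?_
  rw [entry_mul_right, entry_mul_right, h]

lemma entry_add (f g : EndH m n r R) (κ ν : Weight m n r) :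
    entry (f + g) κ ν = entry f κ ν + entry g κ ν := rfl

lemma entry_sub (f g : EndH m n r R) (κ ν : Weight m n r) :
    entry (f - g) κ ν = entry f κ ν - entry g κ ν := rfl

lemma entry_smul (c : R) (f : EndH m n r R) (κ ν : Weight m n r) :
    entry (c • f) κ ν = c • entry f κ ν := rfl

lemma entry_zero (κ ν : Weight m n r) : entry (0 : EndH m n r R) κ ν = 0 := rfl

lemma entry_sum {ι : Type*} (s : Finset ι) (f : ι → EndH m n r R) (κ ν : Weight m n r) :
    entry (∑ a ∈ s, f a) κ ν = ∑ a ∈ s, entry (f a) κ ν := by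
  classical
  induction s using Finset.induction_on with
  | empty => exact entry_zero κ ν
  | insert a s ha ih => rw [Finset.sum_insert ha, Finset.sum_insert ha, entry_add, ih]

open Classical in
lemma entry_one (κ ν : Weight m n r) :
    entry (1 : EndH m n r R) κ ν = if κ = ν then xyElt R ν else 0 := by
  rw [entry, Module.End.one_apply]
  split_ifs with h
  · subst h
    rw [Pi.single_eq_same, SignedPerm.val_mk, mul_one]
  · rw [Pi.single_eq_of_ne h, map_zero]

lemma leftSgn_entry (f : EndH m n r R) (κ ν : Weight m n r) : LeftSgn κ (entry f κ ν) := by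
  obtain ⟨b, hb⟩ := SignedPerm.exists_mk (f (Pi.single ν (SignedPerm.mk R ν 1)) κ)
  rw [entry, hb]
  exact (leftSgn_xyElt κ).mul_right b

/-- The anti-automorphism fixes the generator, so `T_s` also scales it from the right, and a
homomorphism preserves this relation. -/
lemma leftSgn_heckeInv_entry (f : EndH m n r R) (κ ν : Weight m n r) :
    LeftSgn ν (heckeInv r R (entry f κ ν)) := by
  intro i j hij hrow
  have h1 : xyElt R ν * heckeT R (swap i j) = xyElt R ν * (chi R (ν.idx i) • 1) := by
    have := congrArg (heckeInv r R) (leftSgn_xyElt (R := R) ν i j hij hrow)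
    rwa [heckeInv_mul, map_smul, heckeInv_heckeT, swap_inv, heckeInv_xyElt, ← mul_one (xyElt R ν),
      ← mul_smul_comm, mul_one (xyElt R ν)] at this
  have h2 : SignedPerm.mk R ν (heckeT R (swap i j)) = SignedPerm.mk R ν (chi R (ν.idx i) • 1) :=
    SignedPerm.val_injective h1
  have h3 := entry_mul_right f κ ν (heckeT R (swap i j))
  rw [h2, entry_mul_right, mul_smul_comm, mul_one] at h3
  rw [← map_smul, h3, heckeInv_mul, heckeInv_heckeT, swap_inv]

/-- Left multiplication as a homomorphism between signed permutation modules. -/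
noncomputable def SignedPerm.mulLeft (a : Hecke r R) (h : ∃ b, a * xyElt R ν = xyElt R κ * b) :
    SignedPerm R ν →ₗ[(Hecke r R)ᵐᵒᵖ] SignedPerm R κ where
  toFun x := ⟨a * x.val, by
    obtain ⟨b, hb⟩ := h
    obtain ⟨c, rfl⟩ := SignedPerm.exists_mk x
    rw [SignedPerm.val_mk, ← mul_assoc, hb, mul_assoc]
    exact (SignedPerm.mk R κ (b * c)).2⟩
  map_add' x y := SignedPerm.val_injective (mul_add a x.val y.val)
  map_smul' c x := SignedPerm.val_injective (mul_assoc a x.val c.unop).symm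

/-- The right condition writes `F κ ν` as `a * xyElt R ν`, so left multiplication by `a` is a
homomorphism with this value; the left condition puts its image in the target. -/
lemma exists_entry_eq (F : Weight m n r → Weight m n r → Hecke r R)
    (h1 : ∀ κ ν, LeftSgn κ (F κ ν)) (h2 : ∀ κ ν, LeftSgn ν (heckeInv r R (F κ ν))) :
    ∃ f : EndH m n r R, ∀ κ ν, entry f κ ν = F κ ν := by
  classical
  have := Fintype.ofFinite (Weight m n r)
  choose a ha using fun κ ν => exists_eq_mul_xyElt (h2 κ ν)
  have hb : ∀ κ ν, ∃ b, a κ ν * xyElt R ν = xyElt R κ * b := fun κ ν => by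
    rw [← ha]
    exact (h1 κ ν).exists_eq_mul
  refine ⟨LinearMap.pi fun κ => ∑ ν, SignedPerm.mulLeft (a κ ν) (hb κ ν) ∘ₗ LinearMap.proj ν,
    fun κ ν => ?_⟩
  rw [entry, LinearMap.pi_apply, LinearMap.sum_apply, Finset.sum_eq_single ν]
  · rw [LinearMap.comp_apply, LinearMap.proj_apply, Pi.single_eq_same]
    change a κ ν * (xyElt R ν * 1) = _
    rw [mul_one, ha]
  · intro θ _ hne
    rw [LinearMap.comp_apply, LinearMap.proj_apply, Pi.single_eq_of_ne hne, map_zero]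
  · simp

/-- The entries of a composition. -/
lemma entry_mul [Fintype (Weight m n r)] (g f : EndH m n r R) (κ ν : Weight m n r)
    (b : Weight m n r → Hecke r R) (hb : ∀ θ, entry f θ ν = xyElt R θ * b θ) :
    entry (g * f) κ ν = ∑ θ, entry g κ θ * b θ := by
  classical
  have h : f (Pi.single ν (SignedPerm.mk R ν 1)) =
      ∑ θ, Pi.single θ (SignedPerm.mk R θ (b θ)) := by
    rw [Finset.univ_sum_single]
    exact funext fun θ => SignedPerm.val_injective (hb θ)
  rw [entry, Module.End.mul_apply]
  have h' := congrArg g h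
  rw [map_sum] at h'
  have h'' := congrArg (fun x => SignedPerm.val (x κ)) h'
  simp only [Finset.sum_apply, map_sum, entry_mul_right] at h''
  exact h''

lemma entry_proj_mul (a e : ZMod 2) (f : EndH m n r R) (κ ν : Weight m n r) :
    entry (proj m n r R a * f * proj m n r R e) κ ν =
      if κ.parity = a ∧ ν.parity = e then entry f κ ν else 0 := by
  have h : proj m n r R e (Pi.single ν (SignedPerm.mk R ν 1)) =
      if ν.parity = e then Pi.single ν (SignedPerm.mk R ν 1) else 0 := by
    funext θ
    rw [proj, LinearMap.pi_apply]
    by_cases hθ : θ = ν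
    · subst hθ
      split_ifs <;> simp
    · split_ifs <;> simp [hθ]
  rw [entry, Module.End.mul_apply, Module.End.mul_apply, h, proj, LinearMap.pi_apply]
  by_cases h1 : κ.parity = a <;> by_cases h2 : ν.parity = e <;> simp [h1, h2, entry]

lemma entry_homog (i : ZMod 2) (f : EndH m n r R) (κ ν : Weight m n r) :
    entry (homog i f) κ ν = if κ.parity + ν.parity = i then entry f κ ν else 0 := by
  rw [homog, entry_sum]
  simp only [entry_proj_mul]
  rw [Finset.sum_eq_single ν.parity]
  · have h : ∀ a b c : ZMod 2, a = b + c ↔ a + b = c := by decide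
    simp [h]
  · rintro e - he
    rw [if_neg fun hc => he hc.2.symm]
  · simp

/-! ### The standard basis -/

lemma dElt_eq_zero (A : SMat m n r) (h : ¬(ν = A.co ∧ κ = A.ro)) : dElt R κ ν A = 0 := by
  refine Finset.sum_eq_zero fun w hw => absurd ?_ h
  have hA : jmat κ w ν = A.1 := by simpa using hw
  constructor
  · refine Subtype.ext (funext fun j => ?_)
    rw [← sum_jmat_col κ w ν j, hA]
    rfl
  · refine Subtype.ext (funext fun i => ?_)
    rw [← sum_jmat_row κ w ν i, hA]
    rfl

open Classical in
lemma dElt_eq (A : SMat m n r) :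
    dElt R κ ν A = if ν = A.co ∧ κ = A.ro then A.TD R else 0 := by
  split_ifs with h
  · rw [h.1, h.2, SMat.TD_eq]
  · exact dElt_eq_zero A h

lemma isPhi_of_entry {A : SMat m n r} {f : QSchur m n r R}
    (hf : ∀ κ ν, entry f.toEnd κ ν = dElt R κ ν A) : IsPhi A f := by
  classical
  intro ν κ h
  have := entry_mul_right f.toEnd κ ν h
  rw [hf, dElt_eq, ite_mul, zero_mul] at this
  convert this

lemma exists_isPhi (A : SMat m n r) :
    ∃ f : QSchur m n r R, ∀ κ ν, entry f.toEnd κ ν = dElt R κ ν A := by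
  obtain ⟨f, hf⟩ := exists_entry_eq (R := R) (fun κ ν => dElt R κ ν A)
    (fun κ ν => leftSgn_dElt A) (fun κ ν => by rw [heckeInv_dElt]; exact leftSgn_dElt _)
  exact ⟨QSchur.toEnd.symm f, hf⟩

lemma isPhi_phi (A : SMat m n r) : IsPhi A (phi R A) :=
  Classical.epsilon_spec (p := IsPhi A) ((exists_isPhi A).imp fun _ => isPhi_of_entry)

lemma entry_phi (A : SMat m n r) (κ ν : Weight m n r) :
    entry (phi R A).toEnd κ ν = dElt R κ ν A := by
  obtain ⟨f, hf⟩ := exists_isPhi (R := R) A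
  rw [(isPhi_phi A).unique (isPhi_of_entry hf), hf]

variable (R) in
/-- The coefficient of `phi_A`. -/
noncomputable def phiCoef (A : SMat m n r) : QSchur m n r R →ₗ[R] R where
  toFun f := coef r R (entry f.toEnd A.ro A.co) A.rep
  map_add' f g := by rw [map_add, entry_add, map_add, Pi.add_apply]
  map_smul' c f := by rw [map_smul, entry_smul, map_smul]; rfl

-- This duality yields linear independence over every `R` and supplies the coefficients used for
-- spanning.
open Classical in
lemma phiCoef_phi (A B : SMat m n r) : phiCoef R A (phi R B) = if A = B then 1 else 0 := by
  rw [← coef_dElt_rep, ← entry_phi]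
  rfl

variable (R) in
lemma linearIndependent_phi : LinearIndependent R (fun A : SMat m n r => phi R A) := by
  classical
  rw [linearIndependent_iff']
  intro s g hg A hA
  have := congrArg (phiCoef R A) hg
  simpa [phiCoef_phi, hA] using this

instance : Finite (SMat m n r) :=
  Finite.of_injective
    (fun A i j => (⟨A.1 i j, Nat.lt_succ_of_le (((Finset.single_le_sum (f := fun j => A.1 i j)
      (fun _ _ => Nat.zero_le _) (Finset.mem_univ j)).trans
      (Finset.single_le_sum (f := fun i => ∑ j, A.1 i j) (fun _ _ => Nat.zero_le _)
        (Finset.mem_univ i))).trans_eq A.2.2)⟩ : Fin (r + 1)))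
    fun _ _ h => Subtype.ext <| funext fun i => funext fun j =>
      congrArg Fin.val (congrFun (congrFun h i) j)

lemma sum_phiCoef [Fintype (SMat m n r)]
    (hR : 0 < m → 0 < n → 2 ≤ r → 1 + (vUnit R : R) ^ 2 ∈ nonZeroDivisors R)
    (f : QSchur m n r R) : ∑ A, phiCoef R A f • phi R A = f := by
  classical
  refine QSchur.toEnd.injective (entry_ext fun κ ν => sub_eq_zero.1 (Eq.symm ?_))
  symm
  rw [← entry_sub, ← map_sub]
  refine eq_zero_of_coef_rep hR (leftSgn_entry _ _ _) (leftSgn_heckeInv_entry _ _ _) ?_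
  rintro B rfl rfl
  change phiCoef R B _ = 0
  simp [phiCoef_phi]

lemma span_phi (hR : 0 < m → 0 < n → 2 ≤ r → 1 + (vUnit R : R) ^ 2 ∈ nonZeroDivisors R) :
    Submodule.span R (Set.range fun A : SMat m n r => phi R A) = ⊤ := by
  have := Fintype.ofFinite (SMat m n r)
  refine eq_top_iff.2 fun f _ => ?_
  rw [← sum_phiCoef hR f]
  exact sum_mem fun A _ => Submodule.smul_mem _ _ (Submodule.subset_span ⟨A, rfl⟩)

/-- The standard basis. -/
noncomputable def phiBasis
    (hR : 0 < m → 0 < n → 2 ≤ r → 1 + (vUnit R : R) ^ 2 ∈ nonZeroDivisors R) :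
    Module.Basis (SMat m n r) R (QSchur m n r R) :=
  Module.Basis.mk (linearIndependent_phi R) (span_phi hR).ge

lemma phiBasis_apply
    (hR : 0 < m → 0 < n → 2 ≤ r → 1 + (vUnit R : R) ^ 2 ∈ nonZeroDivisors R) (A : SMat m n r) :
    phiBasis hR A = phi R A :=
  Module.Basis.mk_apply _ _ _

/-! ### The anti-involution -/

-- Transposing the matrix of entries while applying `T_w ↦ T_(w⁻¹)` exchanges the left and the right
-- condition, so the result is again the matrix of an endomorphism.
variable (m n r R) in
lemma exists_antiInvolution : ∃ τ : QSchur m n r R →ₗ[R] QSchur m n r R,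
    ∀ f κ ν, entry (τ f).toEnd κ ν = heckeInv r R (entry f.toEnd ν κ) := by
  choose t ht using fun f : QSchur m n r R =>
    exists_entry_eq (fun κ ν => heckeInv r R (entry f.toEnd ν κ))
      (fun κ ν => leftSgn_heckeInv_entry _ _ _) (fun κ ν => by
        rw [heckeInv_heckeInv]; exact leftSgn_entry _ _ _)
  refine ⟨⟨⟨fun f => QSchur.toEnd.symm (t f), fun f g => ?_⟩, fun c f => ?_⟩, ht⟩
  · refine QSchur.toEnd.injective (entry_ext fun κ ν => ?_)
    simp only [map_add, LinearEquiv.apply_symm_apply, entry_add, ht]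
  · refine QSchur.toEnd.injective (entry_ext fun κ ν => ?_)
    simp only [map_smul, LinearEquiv.apply_symm_apply, entry_smul, ht, RingHom.id_apply]

end Entries

/-! ### Composition, odd parts and compatibility with products -/

section Products

variable {m n r : ℕ} {R : Type*} [CommRing R] [Algebra ℤ[T;T⁻¹] R]

/-- The composition of two elements of the quantum Schur superalgebra. -/
def QSchur.comp (f g : QSchur m n r R) : QSchur m n r R := QSchur.toEnd.symm (f.toEnd * g.toEnd)

/-- The odd part of an element of the quantum Schur superalgebra. -/
def QSchur.odd (f : QSchur m n r R) : QSchur m n r R := QSchur.toEnd.symm (homog 1 f.toEnd)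

/-- The sign differs from `1` only for two odd factors. A linear map compatible with composition and
with odd parts thus respects the supermultiplication. -/
lemma QSchur.mul_eq (f g : QSchur m n r R) :
    f * g = f.comp g - (f.odd.comp g.odd + f.odd.comp g.odd) :=
  QSchur.toEnd.injective (QSchur.toEnd_mul f g)

lemma QSchur.eq_comp {f g h : QSchur m n r R} (H : h.toEnd = f.toEnd * g.toEnd) : h = f.comp g :=
  QSchur.toEnd.injective H

lemma QSchur.ext_entry {f g : QSchur m n r R}
    (h : ∀ κ ν, entry f.toEnd κ ν = entry g.toEnd κ ν) : f = g :=
  QSchur.toEnd.injective (entry_ext h)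

lemma entry_comp [Fintype (Weight m n r)] (g f : QSchur m n r R) (κ ν : Weight m n r)
    (b : Weight m n r → Hecke r R) (hb : ∀ θ, entry f.toEnd θ ν = xyElt R θ * b θ) :
    entry (g.comp f).toEnd κ ν = ∑ θ, entry g.toEnd κ θ * b θ :=
  entry_mul g.toEnd f.toEnd κ ν b hb

lemma entry_odd (f : QSchur m n r R) (κ ν : Weight m n r) :
    entry f.odd.toEnd κ ν = if κ.parity + ν.parity = 1 then entry f.toEnd κ ν else 0 :=
  entry_homog 1 f.toEnd κ ν

section AntiInvolution

variable {τ : QSchur m n r R →ₗ[R] QSchur m n r R}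

/-- With the entries of `f` written as `a_θ xy_θ` and those of `g` as `xy_θ b_θ`, the product has
entries `∑ a_θ xy_θ b_θ`, an expression that the anti-automorphism simply reverses. -/
lemma antiInvolution_comp
    (hτ : ∀ f κ ν, entry (τ f).toEnd κ ν = heckeInv r R (entry f.toEnd ν κ))
    (f g : QSchur m n r R) : τ (f.comp g) = (τ g).comp (τ f) := by
  have := Fintype.ofFinite (Weight m n r)
  refine QSchur.ext_entry fun κ ν => ?_
  choose b hb using fun θ => (leftSgn_entry g.toEnd θ κ).exists_eq_mul
  choose a ha using fun θ => exists_eq_mul_xyElt (leftSgn_heckeInv_entry f.toEnd ν θ)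
  rw [hτ, entry_comp _ _ _ _ b hb, map_sum, entry_comp _ _ _ _ (fun θ => heckeInv r R (a θ))]
  · refine Finset.sum_congr rfl fun θ _ => ?_
    rw [hτ, hb, ha, mul_assoc, heckeInv_mul]
  · intro θ
    rw [hτ, ha, heckeInv_mul, heckeInv_xyElt]

lemma antiInvolution_odd
    (hτ : ∀ f κ ν, entry (τ f).toEnd κ ν = heckeInv r R (entry f.toEnd ν κ))
    (f : QSchur m n r R) : τ f.odd = (τ f).odd := by
  refine QSchur.ext_entry fun κ ν => ?_
  rw [hτ, entry_odd, entry_odd, hτ, add_comm]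
  split_ifs
  · rfl
  · exact map_zero _

lemma antiInvolution_mul
    (hτ : ∀ f κ ν, entry (τ f).toEnd κ ν = heckeInv r R (entry f.toEnd ν κ))
    (f g : QSchur m n r R) : τ (f * g) = τ g * τ f := by
  rw [QSchur.mul_eq, QSchur.mul_eq, map_sub, map_add]
  simp only [antiInvolution_comp hτ, antiInvolution_odd hτ]

end AntiInvolution

/-! ### Change of the base ring -/

lemma nonZeroDivisors_laurent :
    1 + (vUnit ℤ[T;T⁻¹] : ℤ[T;T⁻¹]) ^ 2 ∈ nonZeroDivisors ℤ[T;T⁻¹] := by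
  refine mem_nonZeroDivisors_of_ne_zero fun h => ?_
  have hv : (vUnit ℤ[T;T⁻¹] : ℤ[T;T⁻¹]) = LaurentPolynomial.T 1 := rfl
  rw [hv, LaurentPolynomial.T_pow, ← LaurentPolynomial.T_zero] at h
  -- Setting the indeterminate to `1` would give `2 = 0` in `ℤ`.
  have := congrArg (fun p : ℤ[T;T⁻¹] => LaurentPolynomial.eval₂ (RingHom.id ℤ) 1 p) h
  simp at this

/-- The linear isomorphism that maps standard basis to standard basis. -/
noncomputable def baseChange
    (hR : 0 < m → 0 < n → 2 ≤ r → 1 + (vUnit R : R) ^ 2 ∈ nonZeroDivisors R) :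
    R ⊗[ℤ[T;T⁻¹]] QSchur m n r ℤ[T;T⁻¹] ≃ₗ[R] QSchur m n r R :=
  ((phiBasis fun _ _ _ => nonZeroDivisors_laurent).baseChange R).equiv (phiBasis hR) (Equiv.refl _)

section BaseChange

variable (hR : 0 < m → 0 < n → 2 ≤ r → 1 + (vUnit R : R) ^ 2 ∈ nonZeroDivisors R)

lemma baseChange_phi (A : SMat m n r) :
    baseChange hR (1 ⊗ₜ phi ℤ[T;T⁻¹] A) = phi R A := by
  have h1 := Module.Basis.baseChange_apply R
    (phiBasis (m := m) (n := n) (r := r) fun _ _ _ => nonZeroDivisors_laurent) A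
  rw [phiBasis_apply] at h1
  rw [← h1, baseChange, Module.Basis.equiv_apply, phiBasis_apply]
  rfl

/-- By linearity this is a check on the standard basis, whose entries have coefficients that are
powers of `-q` or zero. It reduces products after base change to `heckeMap` being a ring
homomorphism. -/
lemma entry_baseChange (f : QSchur m n r ℤ[T;T⁻¹]) (κ ν : Weight m n r) :
    entry (baseChange hR (1 ⊗ₜ f)).toEnd κ ν = heckeMap r R (entry f.toEnd κ ν) := by
  have := Fintype.ofFinite (SMat m n r)
  rw [← sum_phiCoef (fun _ _ _ => nonZeroDivisors_laurent) f]
  simp only [TensorProduct.tmul_sum, map_sum, entry_sum, map_smul, entry_smul, heckeMap_smul,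
    entry_phi, heckeMap_dElt]
  refine Finset.sum_congr rfl fun A _ => ?_
  rw [TensorProduct.tmul_smul, ← algebraMap_smul R (phiCoef ℤ[T;T⁻¹] A f), map_smul,
    baseChange_phi, map_smul, entry_smul, entry_phi]

/-- `heckeMap` carries a factorisation through the generator to one over `R`, so the formula for the
entries of a composition is preserved. -/
lemma baseChange_comp (f g : QSchur m n r ℤ[T;T⁻¹]) : baseChange hR (1 ⊗ₜ f.comp g) =
    (baseChange hR (1 ⊗ₜ f)).comp (baseChange hR (1 ⊗ₜ g)) := by
  have := Fintype.ofFinite (Weight m n r)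
  refine QSchur.ext_entry fun κ ν => ?_
  choose b hb using fun θ => (leftSgn_entry g.toEnd θ ν).exists_eq_mul
  rw [entry_baseChange, entry_comp _ _ _ _ b hb,
    entry_comp _ _ _ _ (fun θ => heckeMap r R (b θ)), map_sum]
  · simp only [map_mul, entry_baseChange]
  · intro θ
    rw [entry_baseChange, hb, map_mul, heckeMap_xyElt]

lemma baseChange_odd (f : QSchur m n r ℤ[T;T⁻¹]) :
    baseChange hR (1 ⊗ₜ f.odd) = (baseChange hR (1 ⊗ₜ f)).odd := by
  refine QSchur.ext_entry fun κ ν => ?_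
  rw [entry_baseChange, entry_odd, entry_odd, entry_baseChange]
  split_ifs
  · rfl
  · exact map_zero _

lemma baseChange_mul (f g : QSchur m n r ℤ[T;T⁻¹]) : baseChange hR (1 ⊗ₜ (f * g)) =
    baseChange hR (1 ⊗ₜ f) * baseChange hR (1 ⊗ₜ g) := by
  rw [QSchur.mul_eq, QSchur.mul_eq, TensorProduct.tmul_sub, TensorProduct.tmul_add, map_sub,
    map_add]
  simp only [baseChange_comp, baseChange_odd]

lemma baseChange_one : baseChange hR (1 ⊗ₜ 1) = 1 := by
  classical
  refine QSchur.ext_entry fun κ ν => ?_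
  rw [entry_baseChange, QSchur.toEnd_one, QSchur.toEnd_one, entry_one, entry_one]
  split_ifs
  · exact heckeMap_xyElt _
  · exact map_zero (heckeMap r R)

/-- The isomorphism of algebras that maps standard basis to standard basis. -/
noncomputable def baseChangeAlgEquiv :
    R ⊗[ℤ[T;T⁻¹]] QSchur m n r ℤ[T;T⁻¹] ≃ₐ[R] QSchur m n r R :=
  Algebra.TensorProduct.algEquivOfLinearEquivTensorProduct (baseChange hR) (fun a b f g => by
    have h : ∀ (a : R) (f : QSchur m n r ℤ[T;T⁻¹]),
        baseChange hR (a ⊗ₜ f) = a • baseChange hR (1 ⊗ₜ f) := fun a f => by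
      rw [← map_smul, TensorProduct.smul_tmul', smul_eq_mul, mul_one]
    rw [h, h a, h b, baseChange_mul, smul_mul_assoc, mul_smul_comm, mul_smul]) (baseChange_one hR)

end BaseChange

end Products

/-! ### The number of matrices -/

section Count

variable {m n r : ℕ}

/-- The positions of odd parity. -/
abbrev IsOdd (m n : ℕ) (x : Fin (m + n) × Fin (m + n)) : Prop := hat m n x.1 + hat m n x.2 = 1

lemma hat_castAdd (i : Fin m) : hat m n (Fin.castAdd n i) = 0 := by simp [hat]

lemma hat_natAdd (i : Fin n) : hat m n (Fin.natAdd m i) = 1 := by simp [hat]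

lemma card_isOdd (m n : ℕ) : Fintype.card {x // IsOdd m n x} = 2 * m * n := by
  rw [Fintype.card_subtype, Finset.card_filter, Fintype.sum_prod_type]
  simp only [IsOdd, Fin.sum_univ_add, hat_castAdd, hat_natAdd]
  simp [show (1 + 1 : ZMod 2) ≠ 1 by decide]
  ring

lemma card_not_isOdd (m n : ℕ) : Fintype.card {x // ¬IsOdd m n x} = m ^ 2 + n ^ 2 := by
  rw [Fintype.card_subtype, Finset.card_filter, Fintype.sum_prod_type]
  simp only [IsOdd, Fin.sum_univ_add, hat_castAdd, hat_natAdd]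
  simp [show (1 + 1 : ZMod 2) ≠ 1 by decide]
  ring

lemma sum_entries (A : Matrix (Fin (m + n)) (Fin (m + n)) ℕ) : ∑ i, ∑ j, A i j =
    ∑ x : {x // ¬IsOdd m n x}, A x.1.1 x.1.2 + ∑ x : {x // IsOdd m n x}, A x.1.1 x.1.2 :=
  (Fintype.sum_prod_type' fun i j => A i j).symm.trans
    ((Fintype.sum_subtype_add_sum_subtype (IsOdd m n) fun x => A x.1 x.2).symm.trans
      (add_comm _ _))

/-- The matrix with given even part and with the given set of odd entries `1`. -/
def ofParts (f : {x // ¬IsOdd m n x} → ℕ) (s : Finset {x // IsOdd m n x}) :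
    Matrix (Fin (m + n)) (Fin (m + n)) ℕ :=
  fun i j => if h : IsOdd m n (i, j) then (if ⟨(i, j), h⟩ ∈ s then 1 else 0) else f ⟨(i, j), h⟩

lemma ofParts_odd (f : {x // ¬IsOdd m n x} → ℕ) (s : Finset {x // IsOdd m n x})
    (a : {x // IsOdd m n x}) : ofParts f s a.1.1 a.1.2 = if a ∈ s then 1 else 0 :=
  dif_pos a.2

lemma ofParts_even (f : {x // ¬IsOdd m n x} → ℕ) (s : Finset {x // IsOdd m n x})
    (a : {x // ¬IsOdd m n x}) : ofParts f s a.1.1 a.1.2 = f a :=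
  dif_neg a.2

/-- A matrix is given by its entries in even position and by the set of the odd positions of its
entries `1`. -/
def sMatEquiv (m n r : ℕ) : SMat m n r ≃
    {x : ({x // ¬IsOdd m n x} → ℕ) × Finset {x // IsOdd m n x} // ∑ a, x.1 a + x.2.card = r} where
  toFun A := ⟨(fun x => A.1 x.1.1 x.1.2, Finset.univ.filter fun x => A.1 x.1.1 x.1.2 = 1), by
    rw [Finset.card_filter]
    refine Eq.trans ?_ ((sum_entries A.1).symm.trans A.2.2)
    congr 1
    refine Finset.sum_congr rfl fun x _ => ?_
    rcases A.2.1 _ _ x.2 with h | h <;> simp [h]⟩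
  invFun x := ⟨ofParts x.1.1 x.1.2, fun i j h => by
      rw [ofParts_odd _ _ ⟨(i, j), h⟩]
      split_ifs <;> simp, by
    rw [sum_entries]
    refine Eq.trans ?_ x.2
    congr 1
    · exact Finset.sum_congr rfl fun a _ => ofParts_even _ _ a
    · rw [Finset.sum_congr rfl fun a _ => ofParts_odd _ _ a]
      simp⟩
  left_inv A := by
    refine Subtype.ext (funext fun i => funext fun j => ?_)
    by_cases h : IsOdd m n (i, j)
    · refine (ofParts_odd _ _ ⟨(i, j), h⟩).trans ?_
      rcases A.2.1 _ _ h with h' | h' <;> simp [h']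
    · exact ofParts_even _ _ ⟨(i, j), h⟩
  right_inv x := by
    refine Subtype.ext (Prod.ext (funext fun a => ofParts_even _ _ a) ?_)
    ext a
    simp [ofParts_odd]

/-- With `k` the sum of the entries at even positions, these form a multiset of size `k` on `m ^ 2 +
n ^ 2` positions, and the odd entries equal to `1` form a subset of size `r - k` of `2 * m * n`
positions. -/
lemma card_sMat (m n r : ℕ) : Nat.card (SMat m n r) = ∑ k ∈ Finset.range (r + 1),
    (m ^ 2 + n ^ 2 + k - 1).choose k * (2 * m * n).choose (r - k) := by
  let e : {x : ({x // ¬IsOdd m n x} → ℕ) × Finset {x // IsOdd m n x} //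
      ∑ a, x.1 a + x.2.card = r} ≃ Σ k : Fin (r + 1),
      {f : {x // ¬IsOdd m n x} → ℕ // ∑ a, f a = k} ×
        {s : Finset {x // IsOdd m n x} // s.card = r - k} :=
    { toFun := fun x => ⟨⟨∑ a, x.1.1 a, by have := x.2; omega⟩, ⟨x.1.1, rfl⟩, ⟨x.1.2, by
        have := x.2
        dsimp only
        omega⟩⟩
      invFun := fun y => ⟨(y.2.1.1, y.2.2.1), by
        have := y.1.2
        rw [y.2.1.2, y.2.2.2]
        omega⟩
      left_inv := fun x => rfl
      right_inv := by
        rintro ⟨k, ⟨f, hf⟩, ⟨s, hs⟩⟩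
        have hk : ∑ a, f a < r + 1 := hf ▸ k.2
        obtain rfl : k = ⟨∑ a, f a, hk⟩ := Fin.ext hf.symm
        rfl }
  -- The truncated subtraction is harmless: it can only cut off at `k = 0`, where the binomial
  -- coefficient is `1` anyway.
  have h1 : ∀ k : ℕ, Nat.card {f : {x // ¬IsOdd m n x} → ℕ // ∑ a, f a = k} =
      (m ^ 2 + n ^ 2 + k - 1).choose k := fun k => by
    rw [← Nat.card_congr (Sym.equivNatSumOfFintype _ k), Nat.card_eq_fintype_card,
      Sym.card_sym_eq_choose, card_not_isOdd]
  have h2 : ∀ k : ℕ, Nat.card {s : Finset {x // IsOdd m n x} // s.card = k} =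
      (2 * m * n).choose k := fun k => by
    rw [Nat.card_eq_fintype_card, Fintype.card_finset_len, card_isOdd]
  have hfin : ∀ k : ℕ, Finite {f : {x // ¬IsOdd m n x} → ℕ // ∑ a, f a = k} := fun k =>
    Finite.of_equiv _ (Sym.equivNatSumOfFintype _ k)
  rw [Nat.card_congr ((sMatEquiv m n r).trans e), Nat.card_sigma]
  simp only [Nat.card_prod, h1, h2]
  exact Fin.sum_univ_eq_sum_range (fun k => (m ^ 2 + n ^ 2 + k - 1).choose k *
    (2 * m * n).choose (r - k)) (r + 1)

end Count

end QSS

theorem mainTheorem1 (m n r : ℕ) (hmn : m + n ≠ 0)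
    (R : Type*) [CommRing R] [Algebra ℤ[T;T⁻¹] R] :
    -- the elements `phi_A` are well defined and linearly independent
    (∀ A : QSS.SMat m n r, QSS.IsPhi A (QSS.phi R A)) ∧
    LinearIndependent R (fun A : QSS.SMat m n r => QSS.phi R A) ∧
    -- they span, whence the base change property and the rank
    ((0 < m → 0 < n → 2 ≤ r → 1 + (QSS.vUnit R : R) ^ 2 ∈ nonZeroDivisors R) →
      Submodule.span R (Set.range fun A : QSS.SMat m n r => QSS.phi R A) = ⊤ ∧
      (∃ e : R ⊗[ℤ[T;T⁻¹]] QSS.QSchur m n r ℤ[T;T⁻¹] ≃ₐ[R] QSS.QSchur m n r R,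
        (∀ A : QSS.SMat m n r, e (1 ⊗ₜ QSS.phi ℤ[T;T⁻¹] A) = QSS.phi R A) ∧
        ∀ f g h : QSS.QSchur m n r ℤ[T;T⁻¹], h.toEnd = f.toEnd * g.toEnd →
          (e (1 ⊗ₜ h)).toEnd = (e (1 ⊗ₜ f)).toEnd * (e (1 ⊗ₜ g)).toEnd) ∧
      (Nontrivial R →
        Module.finrank R (QSS.QSchur m n r R) = Nat.card (QSS.SMat m n r))) ∧
    Nat.card (QSS.SMat m n r) =
      ∑ k ∈ Finset.range (r + 1),
        (m ^ 2 + n ^ 2 + k - 1).choose k * (2 * m * n).choose (r - k) ∧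
    -- the anti-involution, for the supermultiplication and for composition
    (∃ τ : QSS.QSchur m n r R →ₗ[R] QSS.QSchur m n r R,
      (∀ f, τ (τ f) = f) ∧ τ 1 = 1 ∧ (∀ f g, τ (f * g) = τ g * τ f) ∧
      (∀ f g h, h.toEnd = f.toEnd * g.toEnd → (τ h).toEnd = (τ g).toEnd * (τ f).toEnd) ∧
      ∀ A : QSS.SMat m n r, τ (QSS.phi R A) = QSS.phi R A.transpose) := by
  refine ⟨QSS.isPhi_phi, QSS.linearIndependent_phi R, fun hR => ⟨QSS.span_phi hR,
    ⟨QSS.baseChangeAlgEquiv hR, QSS.baseChange_phi hR, fun f g h hh => ?_⟩, fun _ => ?_⟩,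
    QSS.card_sMat m n r, ?_⟩
  · rw [QSS.QSchur.eq_comp hh]
    exact congrArg QSS.QSchur.toEnd (QSS.baseChange_comp hR f g)
  · exact Module.finrank_eq_nat_card_basis (QSS.phiBasis hR)
  · obtain ⟨τ, hτ⟩ := QSS.exists_antiInvolution m n r R
    refine ⟨τ, fun f => ?_, ?_, QSS.antiInvolution_mul hτ, fun f g h hh => ?_, fun A => ?_⟩
    · refine QSS.QSchur.ext_entry fun κ ν => ?_
      rw [hτ, hτ, QSS.heckeInv_heckeInv]
    · classical
      refine QSS.QSchur.ext_entry fun κ ν => ?_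
      rw [hτ, QSS.QSchur.toEnd_one, QSS.entry_one, QSS.entry_one]
      split_ifs with h1 h2 h2
      · rw [QSS.heckeInv_xyElt, h1]
      · exact absurd h1.symm h2
      · exact absurd h2.symm h1
      · exact map_zero _
    · rw [QSS.QSchur.eq_comp hh, QSS.antiInvolution_comp hτ]
      rfl
    · refine QSS.QSchur.ext_entry fun κ ν => ?_
      rw [hτ, QSS.entry_phi, QSS.entry_phi, QSS.heckeInv_dElt]
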